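/- Propositional formulas are built from variables $X_0,X_1,\dots$ by negation, small (binary) conjunctions and disjunctions $\wedge,\vee$, and big conjunctions and disjunctions $\bigwedge,\bigvee$ of arbitrary finite (possibly empty) sets of formulas. The depth of a formula is the maximum number of nested (big and small) conjunctions and disjunctions in it; its weft is the maximum number of nested big conjunctions and big disjunctions. For $t\le d$ let $\Omega_{t,d}$ be the set of formulas of weft $\le t$ and depth $\le d$. For $d\ge 1$ let $\Gamma_{0,d}$ (respectively $\Delta_{0,d}$) be the set of iterated small conjunctions $((\lambda_1\wedge\lambda_2)\wedge\cdots)\wedge\lambda_r$ (respectively iterated small disjunctions $((\lambda_1\vee\lambda_2)\vee\cdots)\vee\lambda_r$) of $r$ literals, $1\le r\le d$, and for $t\ge 0$ let $$\Gamma_{t+1,d}=\{\textstyle\bigwedge\Pi\mid \Pi\subseteq\Delta_{t,d}\text{ finite}\},\qquad \Delta_{t+1,d}=\{\textstyle\bigvee\Pi\mid \Pi\subseteq\Gamma_{t,d}\text{ finite}\}.$$ A formula $\alpha$ is $k$-satisfiable if some assignment of the variables occurring in $\alpha$ that sets exactly $k$ of them to true satisfies $\alpha$. A parameterized problem is a set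 $Q\subseteq\Sigma^*\times\Pi^*$ with $\Sigma,\Pi$ finite alphabets; for $(x,y)\in\Sigma^*\times\Pi^*$, $x$ is the input and $y$ the parameter. An fpt-reduction from $Q\subseteq\Sigma^*\times\Pi^*$ to $Q'\subseteq(\Sigma')^*\times(\Pi')^*$ is a map $R:\Sigma^*\times\Pi^*\to(\Sigma')^*\times(\Pi')^*$ such that $(x,y)\in Q\iff R(x,y)\in Q'$; such that, for some computable $g:\mathbb N\to\mathbb N$, $R(x,y)=(x',y')$ always implies $|y'|\le g(|y|)$; and such that $R$ is computed by an algorithm (a multi-stack Turing machine) that runs on $(x,y)$ for at most $f(|y|)\cdot p(|x|)$ steps, for some computable $f:\mathbb N\to\mathbb N$ and some polynomial $p$. For a set $\Gamma$ of formulas, $\mathrm{WSat}(\Gamma)$ is the parameterized problem whose input is (an encoding of) a formula $\alpha\in\Gamma$, whose parameter is a number $k\in\mathbb N$ (in binary), and whose question is whether $\alpha$ is $k$-satisfiable. For $t\ge 1$, $\mathrm W[t]$ is the class of all parameterized problems that have an fpt-reduction to $\mathrm{WSat}(\Omega_{t,d})$ for some $d\ge t$. **Statement.** For all $t,d\ge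 1$, $\;\mathrm{WSat}(\Delta_{t+1,d})\in\mathrm W[t]$. -/

import Mathlib

namespace FPT

/-! ### Propositional formulas -/

/-- Propositional formulas over the variables `X n`, `n : ℕ`, with negation, small (binary)
conjunctions and disjunctions, and big conjunctions and disjunctions of arbitrary finite
collections of formulas. The collection is given by a list of its members, as in a written
formula; it may be empty. -/
inductive PropFormula : Type
  | var (n : ℕ) : PropFormula
  | neg (a : PropFormula) : PropFormula
  | and (a b : PropFormula) : PropFormula
  | or (a b : PropFormula) : PropFormula
  | bigAnd (l : List PropFormula) : PropFormula
  | bigOr (l : List PropFormula) : PropFormula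

namespace PropFormula

/-- `a.Sat S`: the assignment under which exactly the variables with index in `S` are true
satisfies `a`. -/
def Sat (S : Finset ℕ) : PropFormula → Prop
  | var n => n ∈ S
  | neg a => ¬ a.Sat S
  | and a b => a.Sat S ∧ b.Sat S
  | or a b => a.Sat S ∨ b.Sat S
  | bigAnd l => ∀ a ∈ l, a.Sat S
  | bigOr l => ∃ a, ∃ _ : a ∈ l, a.Sat S

/-- The set of (indices of) variables occurring in a formula. -/
def vars : PropFormula → Finset ℕ
  | var n => {n}
  | neg a => a.vars
  | and a b => a.vars ∪ b.vars
  | or a b => a.vars ∪ b.vars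
  | bigAnd l => (l.map fun a => a.vars).foldr (· ∪ ·) ∅
  | bigOr l => (l.map fun a => a.vars).foldr (· ∪ ·) ∅

/-- The maximum number of nested (big and small) conjunctions and disjunctions. -/
def depth : PropFormula → ℕ
  | var _ => 0
  | neg a => a.depth
  | and a b => 1 + max a.depth b.depth
  | or a b => 1 + max a.depth b.depth
  | bigAnd l => 1 + (l.map fun a => a.depth).foldr max 0
  | bigOr l => 1 + (l.map fun a => a.depth).foldr max 0

/-- The maximum number of nested big conjunctions and big disjunctions. -/
def weft : PropFormula → ℕ
  | var _ => 0
  | neg a => a.weft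
  | and a b => max a.weft b.weft
  | or a b => max a.weft b.weft
  | bigAnd l => 1 + (l.map fun a => a.weft).foldr max 0
  | bigOr l => 1 + (l.map fun a => a.weft).foldr max 0

/-- A literal is a variable or a negated variable. -/
def IsLiteral (a : PropFormula) : Prop :=
  ∃ n, a = var n ∨ a = neg (var n)

/-- `a` is `k`-satisfiable if some assignment of weight `k` for the variables of `a`
satisfies `a`. -/
def KSat (a : PropFormula) (k : ℕ) : Prop :=
  ∃ S : Finset ℕ, S ⊆ a.vars ∧ S.card = k ∧ a.Sat S

end PropFormula

/-- The class `Ω_{t,d}` of formulas of weft at most `t` and depth at most `d`. -/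
def Omega (t d : ℕ) : Set PropFormula :=
  {a | a.weft ≤ t ∧ a.depth ≤ d}

mutual

/-- The class `Γ_{t,d}`. For `t = 0` it consists of the iterated small conjunctions
`((a₁ ∧ a₂) ∧ …) ∧ aᵣ` of literals with `1 ≤ r ≤ d`. -/
def Gamma : ℕ → ℕ → Set PropFormula
  | 0, d => {a | ∃ (b : PropFormula) (l : List PropFormula),
      b.IsLiteral ∧ (∀ c ∈ l, c.IsLiteral) ∧ l.length + 1 ≤ d ∧ a = l.foldl PropFormula.and b}
  | t + 1, d => {a | ∃ l : List PropFormula, (∀ c ∈ l, c ∈ Delta t d) ∧ a = PropFormula.bigAnd l}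

/-- The class `Δ_{t,d}`. For `t = 0` it consists of the iterated small disjunctions
`((a₁ ∨ a₂) ∨ …) ∨ aᵣ` of literals with `1 ≤ r ≤ d`. -/
def Delta : ℕ → ℕ → Set PropFormula
  | 0, d => {a | ∃ (b : PropFormula) (l : List PropFormula),
      b.IsLiteral ∧ (∀ c ∈ l, c.IsLiteral) ∧ l.length + 1 ≤ d ∧ a = l.foldl PropFormula.or b}
  | t + 1, d => {a | ∃ l : List PropFormula, (∀ c ∈ l, c ∈ Gamma t d) ∧ a = PropFormula.bigOr l}

end

/-! ### Parameterized problems and fpt-reductions -/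

/-- A parameterized problem: a set of pairs `(x, y)`, where the input `x` is a word over the
finite alphabet `Inp` and the parameter `y` is a word over the finite alphabet `Par`. -/
structure ParamProblem : Type 1 where
  Inp : Type
  Par : Type
  finite_inp : Finite Inp
  finite_par : Finite Par
  yes : Set (List Inp × List Par)

/-- The word over the disjoint union of the alphabets that presents a pair `(x, y)` of words to
a machine: `x` followed by `y`. -/
def pairWord {A B : Type} (z : List A × List B) : List (A ⊕ B) :=
  z.1.map Sum.inl ++ z.2.map Sum.inr

/-- `R` is computed by an fpt-algorithm: some (multi-stack Turing) machine computes `R(x, y)` from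
`(x, y)` in at most `f(|y|) * p(|x|)` steps, for a computable `f` and a polynomial `p`. -/
def FptComputable {A B C D : Type} (R : List A × List B → List C × List D) : Prop :=
  ∃ (M : Turing.TM2ComputableAux (A ⊕ B) (C ⊕ D)) (f : ℕ → ℕ) (p : Polynomial ℕ),
    Computable f ∧
    ∀ (x : List A) (y : List B),
      Nonempty (Turing.TM2OutputsInTime M.tm
        ((pairWord (x, y)).map M.inputAlphabet.symm)
        (some ((pairWord (R (x, y))).map M.outputAlphabet.symm))
        (f y.length * p.eval x.length))

/-- `Q ≤ Q'`: there is an fpt-reduction from `Q` to `Q'`. -/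
def FptReducible (Q Q' : ParamProblem) : Prop :=
  ∃ R : List Q.Inp × List Q.Par → List Q'.Inp × List Q'.Par,
    (∀ z, z ∈ Q.yes ↔ R z ∈ Q'.yes) ∧
    (∃ g : ℕ → ℕ, Computable g ∧ ∀ x y, (R (x, y)).2.length ≤ g y.length) ∧
    FptComputable R

/-- The closure `[C]^fpt` of a class of parameterized problems under fpt-reductions. -/
def fptClosure (C : Set ParamProblem) : Set ParamProblem :=
  {Q | ∃ Q' ∈ C, FptReducible Q Q'}

/-! ### Weighted satisfiability and the W-hierarchy -/

/-- The symbols used to write formulas as words. -/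
inductive Sym : Type
  | var | zero | one | neg | and | or | bigAnd | bigOr | close
  deriving DecidableEq

instance : Fintype Sym where
  elems := {.var, .zero, .one, .neg, .and, .or, .bigAnd, .bigOr, .close}
  complete s := by cases s <;> decide

/-- The word that encodes a formula: prefix notation, with variable indices in binary (least
significant bit first) and with a closing symbol at the end of each big conjunction and each big
disjunction. -/
def PropFormula.encode : PropFormula → List Sym
  | .var n => Sym.var :: n.bits.map fun b => if b then Sym.one else Sym.zero
  | .neg a => Sym.neg :: a.encode
  | .and a b => Sym.and :: (a.encode ++ b.encode)
  | .or a b => Sym.or :: (a.encode ++ b.encode)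
  | .bigAnd l => Sym.bigAnd :: ((l.map fun a => a.encode).flatten ++ [Sym.close])
  | .bigOr l => Sym.bigOr :: ((l.map fun a => a.encode).flatten ++ [Sym.close])

/-- The parameterized weighted satisfiability problem `WSat(C)`. Input: a formula `a` in `C`.
Parameter: a natural number `k`, in binary. Question: is `a` `k`-satisfiable? Pairs of words that
do not encode such an input and parameter are no-instances. -/
def WSat (C : Set PropFormula) : ParamProblem where
  Inp := Sym
  Par := Bool
  finite_inp := inferInstance
  finite_par := inferInstance
  yes := {z | ∃ a ∈ C, ∃ k : ℕ, z = (a.encode, k.bits) ∧ a.KSat k}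

/-- The class `W[t]`, for `t ≥ 1`. -/
def W (t : ℕ) : Set ParamProblem :=
  fptClosure {Q | ∃ d, t ≤ d ∧ Q = WSat (Omega t d)}

end FPT

-- For `1 ≤ t`, a formula in `Delta (t + 1) d` is a big disjunction of big conjunctions of formulas
-- from `Delta (t - 1) d`. The outer disjunction is traded for one unit of weight. Each disjunct
-- gets a fresh selector variable Y_i, and the new formula says that at most one selector is true,
-- that some selector is true, and that ¬Y_i ∨ δ holds for every conjunct δ of the i-th disjunct.
-- The guard ¬Y_i is distributed over the literals and big disjunctions of δ, which costs no weft
-- and at most one level of depth. The result therefore has weft at most t (`reduct_mem_Omega`). Its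
-- satisfying assignments of weight k + 1 consist of exactly one selector together with a weight-k
-- assignment of the old variables that makes the selected disjunct true (`kSat_reduct`).
--
-- The rest shows that an fpt-algorithm computes this map. Since t and d are fixed, the words that
-- present instances form a regular language (`isRegular_instanceWords`), so a finite automaton can
-- reject all other words. On instances, the new formula and parameter can be written in one pass
-- from left to right (`TransState.run_instance`), given a counter for the current disjunct and a
-- stack of open connectives. A structured stack program performs this pass in cubic time
-- (`Trans.runs_translate`), and such programs compile to Turing machines that need one additional
-- step to halt (`Prog.Exec.outputs`).

namespace FPT

-- Closure of regular languages under product and star, by counting left quotients.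

section Regular

open Language
open scoped Computability

theorem isRegular_singleton {α : Type} (w : List α) : ({w} : Language α).IsRegular := by
  refine IsRegular.of_finite_range_leftQuotient ?_
  refine (((List.finite_toSet w.tails).image fun v => ({v} : Language α)).union
    (Set.finite_singleton (0 : Language α))).subset ?_
  rintro _ ⟨x, rfl⟩
  by_cases hx : x <+: w
  · obtain ⟨v, rfl⟩ := hx
    left
    refine ⟨v, by simp, ?_⟩
    ext y
    change y = v ↔ x ++ y = x ++ v
    simp
  · right
    change _ = _
    ext y
    change x ++ y = w ↔ False
    exact iff_false_intro fun h => hx ⟨y, h⟩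

/-- After reading x, either the factor from `L` is still open, or x = u ++ v with u in `L` and v
already consumed from the factor in `M`. A quotient is thus determined by one quotient of `L` and a
set of quotients of `M`, which leaves finitely many. -/
theorem _root_.Language.IsRegular.mul {α : Type} {L M : Language α} (hL : L.IsRegular)
    (hM : M.IsRegular) : (L * M).IsRegular := by
  refine IsRegular.of_finite_range_leftQuotient ?_
  refine ((hL.finite_range_leftQuotient.prod hM.finite_range_leftQuotient.powerset).image
    fun p => (p.1 * M + ⨆ N ∈ p.2, N : Language α)).subset ?_
  rintro _ ⟨x, rfl⟩
  refine ⟨(L.leftQuotient x, {N | ∃ u v, u ∈ L ∧ x = u ++ v ∧ N = M.leftQuotient v}),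
    ⟨⟨x, rfl⟩, ?_⟩, ?_⟩
  · rintro _ ⟨u, v, -, -, rfl⟩
    exact ⟨v, rfl⟩
  · ext y
    simp only [mem_add, mem_leftQuotient, mem_mul, mem_iSup]
    constructor
    · rintro (⟨a, ha, b, hb, rfl⟩ | ⟨N, ⟨u, v, hu, rfl, rfl⟩, hy⟩)
      · exact ⟨x ++ a, ha, b, hb, by simp⟩
      · exact ⟨u, hu, v ++ y, hy, by simp⟩
    · rintro ⟨a, ha, b, hb, hab⟩
      rcases List.append_eq_append_iff.1 hab with ⟨c, rfl, rfl⟩ | ⟨c, rfl, rfl⟩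
      · exact Or.inr ⟨_, ⟨a, c, ha, rfl, rfl⟩, hb⟩
      · exact Or.inl ⟨c, ha, b, hb, rfl⟩

/-- A nonempty x is cut as u ++ v, where u consists of complete factors and v is the part of the
current factor that has been read. The quotient depends only on the set of quotients of `L` by such
v. -/
theorem _root_.Language.IsRegular.kstar {α : Type} {L : Language α} (hL : L.IsRegular) :
    (L∗).IsRegular := by
  refine IsRegular.of_finite_range_leftQuotient ?_
  refine ((hL.finite_range_leftQuotient.powerset.image
    fun p => ((⨆ N ∈ p, N) * L∗ : Language α)).union (Set.finite_singleton L∗)).subset ?_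
  rintro _ ⟨x, rfl⟩
  -- For x = [] the general form is L * L∗, which may lack the empty word, so this quotient is
  -- treated apart.
  rcases eq_or_ne x [] with rfl | hx
  · right; simp
  left
  refine ⟨{N | ∃ u v, u ∈ L∗ ∧ x = u ++ v ∧ N = L.leftQuotient v}, ?_, ?_⟩
  · rintro _ ⟨u, v, -, -, rfl⟩
    exact ⟨v, rfl⟩
  · ext y
    simp only [mem_leftQuotient, mem_mul, mem_iSup]
    constructor
    · rintro ⟨a, ⟨N, ⟨u, v, hu, rfl, rfl⟩, hy⟩, b, hb, rfl⟩
      have h1 : v ++ a ∈ L∗ := by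
        have := join_mem_kstar (l := L) (L := [v ++ a]) (by simpa using hy)
        simpa using this
      have key : ∀ {p q : List α}, p ∈ L∗ → q ∈ L∗ → p ++ q ∈ L∗ := by
        intro p q hp hq
        have := append_mem_mul hp hq
        rwa [kstar_mul_kstar] at this
      have := key hu (key h1 hb)
      simpa using this
    · intro h
      obtain ⟨S, hS, hmem⟩ := mem_kstar.1 h
      clear h
      suffices H : ∀ (S : List (List α)) (x : List α), x ≠ [] → x ++ y = S.flatten →
          (∀ w ∈ S, w ∈ L) → ∃ u v a b, u ∈ L∗ ∧ x = u ++ v ∧ v ++ a ∈ L ∧ b ∈ L∗ ∧ a ++ b = y by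
        obtain ⟨u, v, a, b, hu, hv, ha, hb, hab⟩ := H S x hx hS hmem
        exact ⟨a, ⟨_, ⟨u, v, hu, hv, rfl⟩, ha⟩, b, hb, hab⟩
      intro S
      induction S with
      | nil => intro x hx h; simp_all
      | cons w S ih =>
        intro x hx h hmem
        rw [List.flatten_cons] at h
        rcases List.append_eq_append_iff.1 h with ⟨c, hc, hc'⟩ | ⟨c, hc, hc'⟩
        · exact ⟨[], x, c, S.flatten, nil_mem_kstar _, rfl, hc ▸ hmem w (by simp),
            join_mem_kstar fun z hz => hmem z (by simp [hz]), hc'.symm⟩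
        -- If x ends exactly at a factor boundary, the last factor counts as open with nothing left
        -- to read; the induction hypothesis needs a nonempty word.
        · rcases eq_or_ne c [] with rfl | hcne
          · refine ⟨[], x, [], S.flatten, nil_mem_kstar _, rfl, ?_,
              join_mem_kstar fun z hz => hmem z (by simp [hz]), by simpa using hc'⟩
            have := hmem w (by simp)
            simpa [hc] using this
          · obtain ⟨u, v, a, b, hu, hv, ha, hb, hab⟩ :=
              ih c hcne hc'.symm fun z hz => hmem z (by simp [hz])
            refine ⟨w ++ u, v, a, b, ?_, by simp [hc, hv], ha, hb, hab⟩
            obtain ⟨T, rfl, hT⟩ := mem_kstar.1 hu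
            refine mem_kstar.2 ⟨w :: T, by simp, ?_⟩
            simpa using ⟨hmem w (by simp), hT⟩

end Regular

end FPT

-- Structured stack programs and their compilation to Turing machines.

namespace FPT

/-- Structured programs over stacks indexed by `K` with symbols in `Γ` and a register in `S`. -/
inductive Prog (K Γ S : Type) : Type
  | push (k : K) (a : Γ) : Prog K Γ S
  | set (f : S → S) : Prog K Γ S
  | seq (p q : Prog K Γ S) : Prog K Γ S
  | cases (p : S → Prog K Γ S) : Prog K Γ S
  | popCases (k : K) (p : Option Γ → Prog K Γ S) : Prog K Γ S
  | forPop (k : K) (p : Γ → Prog K Γ S) : Prog K Γ S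

namespace Prog

variable {K Γ S : Type}

/-- The labels of the machine that executes a program. -/
def Lab : Prog K Γ S → Type
  | push _ _ => Unit
  | set _ => Unit
  | seq p q => Lab p ⊕ Lab q
  | cases p => Option (Σ s, Lab (p s))
  | popCases _ p => Option (Σ s, Lab (p s))
  | forPop _ p => Option (Σ s, Lab (p s))

theorem finite_lab [Finite Γ] [Finite S] (p : Prog K Γ S) : Finite p.Lab := by
  induction p with
  | push => exact inferInstanceAs (Finite Unit)
  | set => exact inferInstanceAs (Finite Unit)
  | seq p q hp hq => exact inferInstanceAs (Finite (Lab p ⊕ Lab q))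
  | cases p h => exact inferInstanceAs (Finite (Option (Σ s, Lab (p s))))
  | popCases k p h => exact inferInstanceAs (Finite (Option (Σ s, Lab (p s))))
  | forPop k p h => exact inferInstanceAs (Finite (Option (Σ s, Lab (p s))))

/-- The label at which the execution of a program starts. -/
def entry : (p : Prog K Γ S) → p.Lab
  | push _ _ => ()
  | set _ => ()
  | seq p _ => Sum.inl p.entry
  | cases _ => none
  | popCases _ _ => none
  | forPop _ _ => none

/-- The machine code of a program whose labels are embedded into `Λ`; the execution ends with a
jump to the label `exit`. -/
def code {Λ : Type} : (p : Prog K Γ S) → (p.Lab → Λ) → Λ → p.Lab →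
    Turing.TM2.Stmt (fun _ : K => Γ) Λ (Option Γ × S)
  | push k a, _, exit => fun _ => .push k (fun _ => a) (.goto fun _ => exit)
  | set f, _, exit => fun _ => .load (fun v => (v.1, f v.2)) (.goto fun _ => exit)
  | seq p q, emb, exit => fun l => match l with
    | .inl l => code p (fun l => emb (.inl l)) (emb (.inr q.entry)) l
    | .inr l => code q (fun l => emb (.inr l)) exit l
  | cases p, emb, exit => fun l => Option.elim (α := Σ s, Lab (p s)) l
      (.goto fun v => emb (some ⟨v.2, (p v.2).entry⟩))
      fun x => code (p x.1) (fun l => emb (some ⟨x.1, l⟩)) exit x.2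
  | popCases k p, emb, exit => fun l => Option.elim (α := Σ s, Lab (p s)) l
      (.pop k (fun v o => (o, v.2)) (.goto fun v => emb (some ⟨v.1, (p v.1).entry⟩)))
      fun x => code (p x.1) (fun l => emb (some ⟨x.1, l⟩)) exit x.2
  | forPop k p, emb, exit => fun l => Option.elim (α := Σ s, Lab (p s)) l
      (.pop k (fun v o => (o, v.2)) (.goto fun v =>
        v.1.elim exit fun a => emb (some ⟨a, (p a).entry⟩)))
      fun x => code (p x.1) (fun l => emb (some ⟨x.1, l⟩)) (emb none) x.2

variable [DecidableEq K]

open Function in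
/-- `Exec p s T n s' T'`: started with register `s` and stacks `T`, the program `p` ends after `n`
steps with register `s'` and stacks `T'`. -/
inductive Exec : Prog K Γ S → S → (K → List Γ) → ℕ → S → (K → List Γ) → Prop
  | push (k : K) (a : Γ) (s : S) (T : K → List Γ) :
      Exec (push k a) s T 1 s (update T k (a :: T k))
  | set (f : S → S) (s : S) (T : K → List Γ) : Exec (set f) s T 1 (f s) T
  | seq {p q : Prog K Γ S} {s s' s'' : S} {T T' T'' : K → List Γ} {n m : ℕ} :
      Exec p s T n s' T' → Exec q s' T' m s'' T'' → Exec (seq p q) s T (n + m) s'' T''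
  | cases {p : S → Prog K Γ S} {s s' : S} {T T' : K → List Γ} {n : ℕ} :
      Exec (p s) s T n s' T' → Exec (cases p) s T (1 + n) s' T'
  | popCases {k : K} {p : Option Γ → Prog K Γ S} {s s' : S} {T T' : K → List Γ} {n : ℕ} :
      Exec (p (T k).head?) s (update T k (T k).tail) n s' T' → Exec (popCases k p) s T (1 + n) s' T'
  | forPop_nil {k : K} {p : Γ → Prog K Γ S} {s : S} {T : K → List Γ} :
      T k = [] → Exec (forPop k p) s T 1 s T
  | forPop_cons {k : K} {p : Γ → Prog K Γ S} {s s' s'' : S} {T T' T'' : K → List Γ} {n m : ℕ}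
      {a : Γ} {w : List Γ} :
      T k = a :: w → Exec (p a) s (update T k w) n s' T' → Exec (forPop k p) s' T' m s'' T'' →
      Exec (forPop k p) s T (1 + n + m) s'' T''

/-- A step pushes at most one symbol. This bounds the cost of the final clean-up by the running time
before it. -/
theorem Exec.length_le {p : Prog K Γ S} {s s' : S} {T T' : K → List Γ} {n : ℕ}
    (h : Exec p s T n s' T') (k : K) : (T' k).length ≤ (T k).length + n := by
  induction h with
  | push j a s T =>
    rcases eq_or_ne k j with rfl | hk
    · simp
    · simp [hk]
  | set => simp
  | seq _ _ h1 h2 => omega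
  | cases _ h => omega
  | @popCases j p s s' T T' n _ h =>
    rcases eq_or_ne k j with rfl | hk
    · simp at h; omega
    · simp [hk] at h; omega
  | forPop_nil => omega
  | @forPop_cons j p s s' s'' T T' T'' n m a w hT _ _ h1 h2 =>
    rcases eq_or_ne k j with rfl | hk
    · simp at h1; simp [hT]; omega
    · simp [hk] at h1; omega

/-- The step function on machines that may have halted. -/
def iterStep {Λ V : Type} (m : Λ → Turing.TM2.Stmt (fun _ : K => Γ) Λ V) (n : ℕ) :
    Option (Turing.TM2.Cfg (fun _ : K => Γ) Λ V) → Option (Turing.TM2.Cfg (fun _ : K => Γ) Λ V) :=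
  (flip bind (Turing.TM2.step m))^[n]

theorem iterStep_add {Λ V : Type} (m : Λ → Turing.TM2.Stmt (fun _ : K => Γ) Λ V) (a b : ℕ)
    (c : Option (Turing.TM2.Cfg (fun _ : K => Γ) Λ V)) :
    iterStep m (a + b) c = iterStep m b (iterStep m a c) := by
  rw [iterStep, add_comm, Function.iterate_add_apply]; rfl

theorem iterStep_one {Λ V : Type} (m : Λ → Turing.TM2.Stmt (fun _ : K => Γ) Λ V) (l : Λ) (v : V)
    (T : K → List Γ) :
    iterStep m 1 (some ⟨some l, v, T⟩) = some (Turing.TM2.stepAux (m l) v T) := rfl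

/-- `emb` and `exit` are arbitrary because subprograms sit inside larger code. The register for the
popped symbol is arbitrary as well: it is read only directly after a pop. -/
theorem Exec.iterStep {p : Prog K Γ S} {s s' : S} {T T' : K → List Γ} {n : ℕ}
    (h : Exec p s T n s' T') {Λ : Type}
    (m : Λ → Turing.TM2.Stmt (fun _ : K => Γ) Λ (Option Γ × S)) (emb : p.Lab → Λ) (exit : Λ)
    (hm : ∀ l, m (emb l) = p.code emb exit l) (r : Option Γ) :
    ∃ r', Prog.iterStep m n (some ⟨some (emb p.entry), (r, s), T⟩) =
      some ⟨some exit, (r', s'), T'⟩ := by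
  induction h generalizing exit r with
  | push k a s T => exact ⟨r, by rw [iterStep_one, hm]; rfl⟩
  | set f s T => exact ⟨r, by rw [iterStep_one, hm]; rfl⟩
  | @seq p q _ _ _ _ _ _ _ _ _ _ h1 h2 =>
    obtain ⟨r1, e1⟩ := h1 (fun l => emb (.inl l)) (emb (.inr q.entry)) (fun l => hm (.inl l)) r
    obtain ⟨r2, e2⟩ := h2 (fun l => emb (.inr l)) exit (fun l => hm (.inr l)) r1
    exact ⟨r2, by rw [iterStep_add, ← e2, ← e1]; rfl⟩
  | @cases p s _ _ _ _ _ h1 =>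
    obtain ⟨r1, e1⟩ := h1 (fun l => emb (some ⟨s, l⟩)) exit (fun l => hm (some ⟨s, l⟩)) r
    refine ⟨r1, ?_⟩
    rw [iterStep_add, ← e1, iterStep_one, hm]; rfl
  | @popCases k p s _ T _ _ _ h1 =>
    obtain ⟨r1, e1⟩ := h1 (fun l => emb (some ⟨_, l⟩)) exit (fun l => hm (some ⟨_, l⟩))
      (T k).head?
    refine ⟨r1, ?_⟩
    rw [iterStep_add, ← e1, iterStep_one, hm]; rfl
  | @forPop_nil k p s T hT =>
    refine ⟨none, ?_⟩
    rw [iterStep_one, hm]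
    simp [entry, code, Turing.TM2.stepAux, hT]
  | @forPop_cons k p s _ _ T _ _ _ _ a w hT _ _ h1 h2 =>
    obtain ⟨r1, e1⟩ := h1 (fun l => emb (some ⟨a, l⟩)) (emb none) (fun l => hm (some ⟨a, l⟩))
      (some a)
    obtain ⟨r2, e2⟩ := h2 emb exit hm r1
    refine ⟨r2, ?_⟩
    have e0 : Turing.TM2.stepAux ((forPop k p).code emb exit (forPop k p).entry) (r, s) T =
        ⟨some (emb (some ⟨a, (p a).entry⟩)), (some a, s), Function.update T k w⟩ := by
      change (⟨some ((T k).head?.elim exit fun a => emb (some ⟨a, (p a).entry⟩)),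
        ((T k).head?, s), Function.update T k (T k).tail⟩ : Turing.TM2.Cfg _ _ _) = _
      rw [hT]; rfl
    rw [iterStep_add, iterStep_add, ← e2, iterStep_one, hm, e0]
    exact congrArg _ e1

/-- The machine that executes `p` with the initial register value `s₀`, reads its input from the
stack `k₀`, and leaves its output on the same stack. -/
noncomputable def machine [Fintype K] [Fintype Γ] [Fintype S] (p : Prog K Γ S) (k₀ : K)
    (s₀ : S) : Turing.FinTM2 where
  K := K
  k₀ := k₀
  k₁ := k₀
  Γ _ := Γ
  Λ := Option p.Lab
  main := some p.entry
  ΛFin := by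
    have := p.finite_lab
    exact Fintype.ofFinite _
  σ := Option Γ × S
  initialState := (none, s₀)
  Γk₀Fin := inferInstanceAs (Fintype Γ)
  m l := match l with
    | none => .load (fun _ => (none, s₀)) .halt
    | some l => p.code some none l

/-- An accepted final configuration has the initial register and all stacks empty except the output.
The one extra step resets the register and halts; emptying the stacks is left to the program. -/
theorem Exec.outputs [Fintype K] [Fintype Γ] [Fintype S] {p : Prog K Γ S} {k₀ : K} {s₀ s' : S}
    {n N : ℕ} {w w' : List Γ}
    (h : Exec p s₀ (Function.update (fun _ => []) k₀ w) n s'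
      (Function.update (fun _ => []) k₀ w')) (hN : n + 1 ≤ N) :
    Nonempty (Turing.TM2OutputsInTime (p.machine k₀ s₀) w (some w') N) := by
  obtain ⟨r, e⟩ := h.iterStep (p.machine k₀ s₀).m some none (fun l => rfl) none
  refine ⟨⟨⟨n + 1, ?_⟩, hN⟩⟩
  have e2 := iterStep_add (p.machine k₀ s₀).m n 1
    (some ⟨some (some p.entry), (none, s₀), Function.update (fun _ => []) k₀ w⟩)
  have h1 : ∀ v : List Γ, (fun k => @dite (List Γ) (k = k₀) (inferInstance) (fun _ => v) fun _ => []) =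
      Function.update (fun _ => []) k₀ v := by
    intro v; funext k; by_cases hk : k = k₀
    · subst hk; simp
    · simp [hk]
  have hi : Turing.initList (p.machine k₀ s₀) w =
      ⟨some (some p.entry), (none, s₀), Function.update (fun _ => []) k₀ w⟩ :=
    congrArg (Turing.TM2.Cfg.mk (some (some p.entry)) (none, s₀)) (h1 w)
  have hh : Turing.haltList (p.machine k₀ s₀) w' =
      ⟨none, (none, s₀), Function.update (fun _ => []) k₀ w'⟩ :=
    congrArg (Turing.TM2.Cfg.mk none (none, s₀)) (h1 w')
  have hi' := congrArg (fun c => (flip bind (p.machine k₀ s₀).step)^[n + 1] (some c)) hi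
  refine hi'.trans (Eq.trans ?_ (congrArg some hh).symm)
  exact e2.trans (congrArg _ e)

end Prog

end FPT

-- Unique readability of encodings, and regularity of the set of instances.

namespace FPT

/-- The binary notations of the natural numbers, with digits `f b`. -/
def bitWords {α : Type} (f : Bool → α) : Language α := {w | ∃ n : ℕ, w = n.bits.map f}

open Language in
-- With the least significant digit first, a binary notation is either empty or any word that ends
-- in the digit one.
theorem isRegular_bitWords {α : Type} (f : Bool → α) : (bitWords f).IsRegular := by
  have h : bitWords f =
      {[]} + KStar.kstar ({[f false]} + {[f true]}) * {[f true]} := by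
    ext w
    rw [mem_add, mem_mul]
    change (∃ n : ℕ, w = n.bits.map f) ↔ w = [] ∨ _
    constructor
    · rintro ⟨n, rfl⟩
      induction n using Nat.binaryRec' with
      | zero => left; simp
      | bit b n hn ih =>
        right
        rw [Nat.bits_append_bit _ _ hn, List.map_cons]
        have hb : [f b] ∈ ({[f false]} + {[f true]} : Language α) := by
          cases b
          · exact Or.inl rfl
          · exact Or.inr rfl
        rcases ih with ih | ⟨u, hu, v, hv, huv⟩
        · rw [ih]
          have : n = 0 := by
            rw [List.map_eq_nil_iff] at ih
            by_contra h0
            have := Nat.digits_ne_nil_iff_ne_zero (b := 2).2 h0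
            rw [Nat.digits_two_eq_bits, ih] at this
            simp at this
          exact ⟨[], nil_mem_kstar _, [f true], rfl, by simp [hn this]⟩
        · obtain ⟨T, rfl, hT⟩ := mem_kstar.1 hu
          refine ⟨f b :: T.flatten, mem_kstar.2 ⟨[f b] :: T, by simp, ?_⟩, v, hv, by simp [huv]⟩
          intro y hy
          rcases List.mem_cons.1 hy with rfl | hy
          · exact hb
          · exact hT y hy
    · rintro (rfl | ⟨u, hu, v, hv, rfl⟩)
      · exact ⟨0, by simp⟩
      · obtain ⟨T, rfl, hT⟩ := mem_kstar.1 hu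
        change v = _ at hv
        subst hv
        clear hu
        suffices H : ∃ n : ℕ, n ≠ 0 ∧ T.flatten ++ [f true] = n.bits.map f from
          H.imp fun n h => h.2
        induction T with
        | nil => exact ⟨1, by simp, by simp⟩
        | cons y T ih =>
          obtain ⟨n, h0, hn⟩ := ih fun y hy => hT y (by simp [hy])
          have hb : ∃ b, y = [f b] := by
            rcases hT y (by simp) with h | h
            · exact ⟨false, h⟩
            · exact ⟨true, h⟩
          obtain ⟨b, rfl⟩ := hb
          refine ⟨Nat.bit b n, by simp [h0], ?_⟩
          rw [Nat.bits_append_bit _ _ fun h => absurd h h0]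
          simp [hn]
  rw [h]
  exact (isRegular_singleton _).add
    (((isRegular_singleton _).add (isRegular_singleton _)).kstar.mul (isRegular_singleton _))

namespace PropFormula

theorem induct {P : PropFormula → Prop} (var : ∀ n, P (var n)) (neg : ∀ a, P a → P (neg a))
    (and : ∀ a b, P a → P b → P (and a b)) (or : ∀ a b, P a → P b → P (or a b))
    (bigAnd : ∀ l, (∀ a ∈ l, P a) → P (bigAnd l)) (bigOr : ∀ l, (∀ a ∈ l, P a) → P (bigOr l)) :
    ∀ a, P a
  | .var n => var n
  | .neg a => neg a (induct var neg and or bigAnd bigOr a)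
  | .and a b => and a b (induct var neg and or bigAnd bigOr a)
      (induct var neg and or bigAnd bigOr b)
  | .or a b => or a b (induct var neg and or bigAnd bigOr a)
      (induct var neg and or bigAnd bigOr b)
  | .bigAnd l => bigAnd l fun a _ => induct var neg and or bigAnd bigOr a
  | .bigOr l => bigOr l fun a _ => induct var neg and or bigAnd bigOr a

theorem mem_vars_bigAnd {l : List PropFormula} {v : ℕ} :
    v ∈ (bigAnd l).vars ↔ ∃ a ∈ l, v ∈ a.vars := by
  rw [vars]
  induction l <;> simp_all

theorem mem_vars_bigOr {l : List PropFormula} {v : ℕ} :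
    v ∈ (bigOr l).vars ↔ ∃ a ∈ l, v ∈ a.vars := by
  rw [vars]
  induction l <;> simp_all

theorem sat_bigOr {l : List PropFormula} {S : Finset ℕ} :
    (bigOr l).Sat S ↔ ∃ a ∈ l, a.Sat S := by
  rw [Sat]; simp

theorem foldr_max_le {f : PropFormula → ℕ} {l : List PropFormula} {N : ℕ} :
    (l.map fun a => f a).foldr max 0 ≤ N ↔ ∀ a ∈ l, f a ≤ N := by
  induction l <;> simp_all

theorem le_foldr_max {f : PropFormula → ℕ} {l : List PropFormula} {a : PropFormula} (h : a ∈ l) :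
    f a ≤ (l.map fun a => f a).foldr max 0 :=
  foldr_max_le.1 le_rfl a h

/-- A word that does not start with a binary digit. -/
def NoDigit (u : List Sym) : Prop := ∀ c ∈ u.head?, c ≠ Sym.zero ∧ c ≠ Sym.one

theorem noDigit_encode_append (a : PropFormula) (u : List Sym) : NoDigit (a.encode ++ u) := by
  cases a <;> simp [NoDigit, encode]

theorem _root_.Nat.bits_injective : Function.Injective Nat.bits := by
  intro m n h
  exact Nat.digits.injective 2 (by rw [Nat.digits_two_eq_bits, Nat.digits_two_eq_bits, h])

theorem digits_append_inj {p q : List Bool} {u v : List Sym} (hu : NoDigit u) (hv : NoDigit v)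
    (h : (p.map fun b => if b then Sym.one else Sym.zero) ++ u =
      (q.map fun b => if b then Sym.one else Sym.zero) ++ v) : p = q ∧ u = v := by
  induction p generalizing q with
  | nil =>
    cases q with
    | nil => exact ⟨rfl, h⟩
    | cons b q =>
      simp at h
      subst h
      have := hu _ rfl
      cases b <;> simp at this
  | cons a p ih =>
    cases q with
    | nil =>
      simp at h
      subst h
      have := hv _ rfl
      cases a <;> simp at this
    | cons b q =>
      simp only [List.map_cons, List.cons_append, List.cons.injEq] at h
      obtain ⟨rfl, rfl⟩ := ih h.2
      refine ⟨?_, rfl⟩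
      cases a <;> cases b <;> simp_all

/-- No encoding starts with the closing symbol, so both lists end at the same place. -/
theorem flatten_encode_inj {l l' : List PropFormula} {u v : List Sym}
    (ih : ∀ a ∈ l, ∀ b u v, NoDigit u → NoDigit v → a.encode ++ u = b.encode ++ v → a = b ∧ u = v)
    (h : (l.map fun a => a.encode).flatten ++ Sym.close :: u =
      (l'.map fun a => a.encode).flatten ++ Sym.close :: v) : l = l' ∧ u = v := by
  have hnd : ∀ (l : List PropFormula) (u : List Sym),
      NoDigit ((l.map fun a => a.encode).flatten ++ Sym.close :: u) := by
    intro l u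
    cases l with
    | nil => simp [NoDigit]
    | cons a l =>
      rw [List.map_cons, List.flatten_cons, List.append_assoc]
      exact noDigit_encode_append a _
  induction l generalizing l' with
  | nil =>
    cases l' with
    | nil => simpa using h
    | cons b l' => cases b <;> simp [encode] at h
  | cons a l IH =>
    cases l' with
    | nil => cases a <;> simp [encode] at h
    | cons b l' =>
      simp only [List.map_cons, List.flatten_cons, List.append_assoc] at h
      obtain ⟨rfl, h'⟩ := ih a (by simp) b _ _ (hnd _ _) (hnd _ _) h
      obtain ⟨rfl, rfl⟩ := IH (fun a ha => ih a (by simp [ha])) h'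
      exact ⟨rfl, rfl⟩

/-- The induction needs trailing words. They must not start with a digit, because the index of a
variable has no end marker. -/
theorem encode_append_inj (a : PropFormula) : ∀ (b : PropFormula) (u v : List Sym), NoDigit u →
    NoDigit v → a.encode ++ u = b.encode ++ v → a = b ∧ u = v := by
  induction a using induct with
  | var n =>
    intro b u v hu hv h
    cases b with
    | var m =>
      simp only [encode, List.cons_append, List.cons.injEq, true_and] at h
      obtain ⟨h1, rfl⟩ := digits_append_inj hu hv h
      exact ⟨congrArg _ (Nat.bits_injective h1), rfl⟩
    | _ => simp [encode] at h
  | neg a ih =>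
    intro b u v hu hv h
    cases b with
    | neg b =>
      simp only [encode, List.cons_append, List.cons.injEq, true_and] at h
      obtain ⟨rfl, rfl⟩ := ih _ _ _ hu hv h
      exact ⟨rfl, rfl⟩
    | _ => simp [encode] at h
  | and a a' ih ih' =>
    intro b u v hu hv h
    cases b with
    | and b b' =>
      simp only [encode, List.cons_append, List.cons.injEq, true_and, List.append_assoc] at h
      obtain ⟨rfl, h1⟩ := ih _ _ _ (noDigit_encode_append _ _) (noDigit_encode_append _ _) h
      obtain ⟨rfl, rfl⟩ := ih' _ _ _ hu hv h1
      exact ⟨rfl, rfl⟩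
    | _ => simp [encode] at h
  | or a a' ih ih' =>
    intro b u v hu hv h
    cases b with
    | or b b' =>
      simp only [encode, List.cons_append, List.cons.injEq, true_and, List.append_assoc] at h
      obtain ⟨rfl, h1⟩ := ih _ _ _ (noDigit_encode_append _ _) (noDigit_encode_append _ _) h
      obtain ⟨rfl, rfl⟩ := ih' _ _ _ hu hv h1
      exact ⟨rfl, rfl⟩
    | _ => simp [encode] at h
  | bigAnd l ih =>
    intro b u v hu hv h
    cases b with
    | bigAnd l' =>
      simp only [encode, List.cons_append, List.cons.injEq, true_and, List.append_assoc,
        List.nil_append] at h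
      obtain ⟨rfl, rfl⟩ := flatten_encode_inj ih h
      exact ⟨rfl, rfl⟩
    | _ => simp [encode] at h
  | bigOr l ih =>
    intro b u v hu hv h
    cases b with
    | bigOr l' =>
      simp only [encode, List.cons_append, List.cons.injEq, true_and, List.append_assoc,
        List.nil_append] at h
      obtain ⟨rfl, rfl⟩ := flatten_encode_inj ih h
      exact ⟨rfl, rfl⟩
    | _ => simp [encode] at h

theorem encode_injective : Function.Injective encode := fun a b h =>
  (encode_append_inj a b [] [] (by simp [NoDigit]) (by simp [NoDigit]) (by simpa using h)).1

theorem encode_ne_nil (a : PropFormula) : a.encode ≠ [] := by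
  cases a <;> simp [encode]

section Regular

open Language

variable {α : Type} (g : Sym → α)

/-- The words over `α` that encode the formulas in a class. -/
def words (C : Set PropFormula) : Language α := {w | ∃ a ∈ C, w = a.encode.map g}

theorem isRegular_words_literal : (words g {a | a.IsLiteral}).IsRegular := by
  have h : words g {a | a.IsLiteral} = ({[g .var]} + {[g .neg, g .var]}) *
      bitWords fun b => g (if b then Sym.one else Sym.zero) := by
    ext w
    rw [add_mul, mem_add, mem_mul, mem_mul]
    constructor
    · rintro ⟨_, ⟨n, rfl | rfl⟩, rfl⟩
      · exact Or.inl ⟨[g .var], rfl, _, ⟨n, rfl⟩, by simp [encode]⟩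
      · exact Or.inr ⟨[g .neg, g .var], rfl, _, ⟨n, rfl⟩, by simp [encode]⟩
    · rintro (⟨_, rfl, _, ⟨n, rfl⟩, rfl⟩ | ⟨_, rfl, _, ⟨n, rfl⟩, rfl⟩)
      · exact ⟨.var n, ⟨n, Or.inl rfl⟩, by simp [encode]⟩
      · exact ⟨.neg (.var n), ⟨n, Or.inr rfl⟩, by simp [encode]⟩
  rw [h]
  exact ((isRegular_singleton _).add (isRegular_singleton _)).mul (isRegular_bitWords _)

/-- In prefix notation, appending a literal to a left-nested chain puts one more `s` in front and
the literal at the end. Each exact length gives a regular language, and only finitely many lengths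
occur. -/
theorem isRegular_words_foldl (op : PropFormula → PropFormula → PropFormula) (s : Sym)
    (hop : ∀ a b, (op a b).encode = s :: (a.encode ++ b.encode)) (d : ℕ) :
    (words g {a | ∃ (b : PropFormula) (l : List PropFormula), b.IsLiteral ∧
      (∀ c ∈ l, c.IsLiteral) ∧ l.length + 1 ≤ d ∧ a = l.foldl op b}).IsRegular := by
  have hex : ∀ r, (words g {a | ∃ (b : PropFormula) (l : List PropFormula), b.IsLiteral ∧
      (∀ c ∈ l, c.IsLiteral) ∧ l.length = r ∧ a = l.foldl op b}).IsRegular := by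
    intro r
    induction r with
    | zero =>
      convert isRegular_words_literal g using 2
      ext a
      constructor
      · rintro ⟨b, l, hb, -, hl, rfl⟩
        rw [List.length_eq_zero_iff] at hl
        subst hl
        exact hb
      · exact fun h => ⟨a, [], h, by simp⟩
    | succ r ih =>
      convert ((isRegular_singleton [g s]).mul ih).mul (isRegular_words_literal g) using 1
      ext w
      simp only [mem_mul]
      constructor
      · rintro ⟨_, ⟨b, l, hb, hl, hr, rfl⟩, rfl⟩
        obtain ⟨l, c, rfl⟩ : ∃ l' c, l = l' ++ [c] :=
          ⟨l.dropLast, l.getLast (by rintro rfl; simp at hr), (List.dropLast_append_getLast _).symm⟩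
        refine ⟨_, ⟨[g s], rfl, _, ⟨_, ⟨b, l, hb, fun c hc => hl c (by simp [hc]), ?_, rfl⟩, rfl⟩,
          rfl⟩, _, ⟨c, hl c (by simp), rfl⟩, ?_⟩
        · simpa using hr
        · simp [hop]
      · rintro ⟨_, ⟨_, rfl, _, ⟨_, ⟨b, l, hb, hl, hr, rfl⟩, rfl⟩, rfl⟩, _, ⟨c, hc, rfl⟩, rfl⟩
        refine ⟨_, ⟨b, l ++ [c], hb, ?_, by simp [hr], rfl⟩, by simp [hop]⟩
        intro x hx
        rcases List.mem_append.1 hx with hx | hx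
        · exact hl x hx
        · rw [List.mem_singleton.1 hx]; exact hc
  induction d with
  | zero =>
    -- The class is empty for d = 0; the empty language is written as an intersection of
    -- complements.
    convert (hex 0).inf (hex 0).compl using 1
    ext w
    constructor
    · rintro ⟨_, ⟨b, l, _, _, h, _⟩, _⟩
      omega
    · exact fun h => absurd h.1 h.2
  | succ d ih =>
    convert ih.add (hex d) using 1
    ext w
    rw [mem_add]
    constructor
    · rintro ⟨_, ⟨b, l, hb, hl, hr, rfl⟩, rfl⟩
      rcases Nat.lt_or_ge l.length d with h | h
      · exact Or.inl ⟨_, ⟨b, l, hb, hl, h, rfl⟩, rfl⟩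
      · exact Or.inr ⟨_, ⟨b, l, hb, hl, by omega, rfl⟩, rfl⟩
    · rintro (⟨_, ⟨b, l, hb, hl, hr, rfl⟩, rfl⟩ | ⟨_, ⟨b, l, hb, hl, hr, rfl⟩, rfl⟩)
      · exact ⟨_, ⟨b, l, hb, hl, by omega, rfl⟩, rfl⟩
      · exact ⟨_, ⟨b, l, hb, hl, by omega, rfl⟩, rfl⟩

theorem isRegular_words_big (op : List PropFormula → PropFormula) (s : Sym)
    (hop : ∀ l, (op l).encode = s :: ((l.map fun a => a.encode).flatten ++ [Sym.close]))
    {C : Set PropFormula} (hC : (words g C).IsRegular) :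
    (words g {a | ∃ l : List PropFormula, (∀ c ∈ l, c ∈ C) ∧ a = op l}).IsRegular := by
  convert ((isRegular_singleton [g s]).mul hC.kstar).mul (isRegular_singleton [g .close]) using 1
  ext w
  simp only [mem_mul]
  constructor
  · rintro ⟨_, ⟨l, hl, rfl⟩, rfl⟩
    refine ⟨_, ⟨[g s], rfl, _, mem_kstar.2 ⟨l.map fun a => a.encode.map g, rfl, ?_⟩, rfl⟩, _, rfl,
      ?_⟩
    · intro y hy
      obtain ⟨a, ha, rfl⟩ := List.mem_map.1 hy
      exact ⟨a, hl a ha, rfl⟩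
    · simp [hop, List.map_flatten, Function.comp_def]
  · rintro ⟨_, ⟨_, rfl, _, hx, rfl⟩, _, rfl, rfl⟩
    obtain ⟨T, rfl, hT⟩ := mem_kstar.1 hx
    obtain ⟨l, hl, rfl⟩ : ∃ l : List PropFormula, (∀ c ∈ l, c ∈ C) ∧
        T = l.map fun a => a.encode.map g := by
      clear hx
      induction T with
      | nil => exact ⟨[], by simp⟩
      | cons y T ih =>
        obtain ⟨l, hl, rfl⟩ := ih fun y hy => hT y (by simp [hy])
        obtain ⟨a, ha, rfl⟩ := hT y (by simp)
        exact ⟨a :: l, by simpa using ⟨ha, hl⟩, rfl⟩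
    exact ⟨_, ⟨l, hl, rfl⟩, by simp [hop, List.map_flatten, Function.comp_def]⟩

/-- The nesting of big connectives is fixed by `t`, so no brackets need to be counted: each level
adds one star. -/
theorem isRegular_words (t d : ℕ) :
    (words g (Gamma t d)).IsRegular ∧ (words g (Delta t d)).IsRegular := by
  induction t with
  | zero =>
    rw [Gamma, Delta]
    exact ⟨isRegular_words_foldl g .and .and (fun a b => by rw [encode]) d,
      isRegular_words_foldl g .or .or (fun a b => by rw [encode]) d⟩
  | succ t ih =>
    rw [Gamma, Delta]
    exact ⟨isRegular_words_big g .bigAnd .bigAnd (fun a => by rw [encode]) ih.2,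
      isRegular_words_big g .bigOr .bigOr (fun a => by rw [encode]) ih.1⟩

end Regular

end PropFormula

/-- The words that present a formula in `Δ_{t,d}` and a number. -/
def instanceWords (t d : ℕ) : Language (Sym ⊕ Bool) :=
  {w | ∃ a ∈ Delta t d, ∃ k : ℕ, w = pairWord (a.encode, k.bits)}

theorem isRegular_instanceWords (t d : ℕ) : (instanceWords t d).IsRegular := by
  convert (PropFormula.isRegular_words Sum.inl t d).2.mul (isRegular_bitWords (Sum.inr (α := Sym)))
    using 1
  ext w
  rw [Language.mem_mul]
  constructor
  · rintro ⟨a, ha, k, rfl⟩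
    exact ⟨_, ⟨a, ha, rfl⟩, _, ⟨k, rfl⟩, rfl⟩
  · rintro ⟨_, ⟨a, ha, rfl⟩, _, ⟨k, rfl⟩, rfl⟩
    exact ⟨a, ha, k, rfl⟩

end FPT

-- The reduction on formulas: selectors and relativization.

namespace FPT

namespace PropFormula

/-- Formulas in which only variables are negated. -/
inductive NNF : PropFormula → Prop
  | var (n : ℕ) : NNF (var n)
  | neg (n : ℕ) : NNF (neg (.var n))
  | and {a b : PropFormula} : NNF a → NNF b → NNF (and a b)
  | or {a b : PropFormula} : NNF a → NNF b → NNF (or a b)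
  | bigAnd {l : List PropFormula} : (∀ a ∈ l, NNF a) → NNF (bigAnd l)
  | bigOr {l : List PropFormula} : (∀ a ∈ l, NNF a) → NNF (bigOr l)

theorem IsLiteral.nnf {a : PropFormula} (h : a.IsLiteral) : a.NNF := by
  obtain ⟨n, rfl | rfl⟩ := h
  · exact .var n
  · exact .neg n

theorem foldl_induction {P : PropFormula → Prop} {op : PropFormula → PropFormula → PropFormula}
    (hop : ∀ a b, P a → P b → P (op a b)) {b : PropFormula} {l : List PropFormula} (hb : P b)
    (hl : ∀ c ∈ l, P c) : P (l.foldl op b) := by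
  induction l generalizing b with
  | nil => exact hb
  | cons c l ih => exact ih (hop _ _ hb (hl c (by simp))) fun x hx => hl x (by simp [hx])

theorem nnf_of_mem (t d : ℕ) : (∀ a ∈ Gamma t d, a.NNF) ∧ ∀ a ∈ Delta t d, a.NNF := by
  induction t with
  | zero =>
    rw [Gamma, Delta]
    constructor
    · rintro _ ⟨b, l, hb, hl, -, rfl⟩
      exact foldl_induction (fun _ _ => .and) hb.nnf fun c hc => (hl c hc).nnf
    · rintro _ ⟨b, l, hb, hl, -, rfl⟩
      exact foldl_induction (fun _ _ => .or) hb.nnf fun c hc => (hl c hc).nnf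
  | succ t ih =>
    rw [Gamma, Delta]
    constructor
    · rintro _ ⟨l, hl, rfl⟩
      exact .bigAnd fun a ha => ih.2 a (hl a ha)
    · rintro _ ⟨l, hl, rfl⟩
      exact .bigOr fun a ha => ih.1 a (hl a ha)

theorem IsLiteral.weft_depth {a : PropFormula} (h : a.IsLiteral) : a.weft = 0 ∧ a.depth = 0 := by
  obtain ⟨n, rfl | rfl⟩ := h <;> simp [weft, depth]

theorem weft_depth_of_mem (t d : ℕ) : (∀ a ∈ Gamma t d, a.weft ≤ t ∧ a.depth ≤ t + d) ∧
    ∀ a ∈ Delta t d, a.weft ≤ t ∧ a.depth ≤ t + d := by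
  -- The chain nests to the left, so each further literal adds one level above the accumulated
  -- formula and no weft.
  have key : ∀ (op : PropFormula → PropFormula → PropFormula),
      (∀ a b, (op a b).weft = max a.weft b.weft ∧ (op a b).depth = 1 + max a.depth b.depth) →
      ∀ (b : PropFormula) (l : List PropFormula) (N : ℕ), b.weft = 0 → b.depth ≤ N →
      (∀ c ∈ l, c.IsLiteral) →
      (l.foldl op b).weft ≤ 0 ∧ (l.foldl op b).depth ≤ N + l.length := by
    intro op hop b l
    induction l generalizing b with
    | nil => intro N h1 h2 _; exact ⟨h1.le, h2⟩
    | cons c l ih =>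
      intro N h1 h2 hl
      have hc := (hl c (by simp)).weft_depth
      have := ih (op b c) (N + 1) (by simp [hop, h1, hc]) (by simp [hop, hc]; omega)
        fun x hx => hl x (by simp [hx])
      simp only [List.foldl_cons, List.length_cons]
      omega
  induction t with
  | zero =>
    rw [Gamma, Delta]
    constructor
    · rintro _ ⟨b, l, hb, hl, h, rfl⟩
      have := key .and (fun a b => by simp [weft, depth]) b l 0 hb.weft_depth.1
        hb.weft_depth.2.le hl
      omega
    · rintro _ ⟨b, l, hb, hl, h, rfl⟩
      have := key .or (fun a b => by simp [weft, depth]) b l 0 hb.weft_depth.1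
        hb.weft_depth.2.le hl
      omega
  | succ t ih =>
    rw [Gamma, Delta]
    constructor
    · rintro _ ⟨l, hl, rfl⟩
      have h1 := (foldr_max_le (f := weft)).2 fun a ha => (ih.2 a (hl a ha)).1
      have h2 := (foldr_max_le (f := depth)).2 fun a ha => (ih.2 a (hl a ha)).2
      rw [weft, depth]
      omega
    · rintro _ ⟨l, hl, rfl⟩
      have h1 := (foldr_max_le (f := weft)).2 fun a ha => (ih.1 a (hl a ha)).1
      have h2 := (foldr_max_le (f := depth)).2 fun a ha => (ih.1 a (hl a ha)).2
      rw [weft, depth]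
      omega

/-- The variable that selects the `i`-th member of a big disjunction. -/
def sel (i : ℕ) : PropFormula := var (2 ^ (i + 1))

/-- The relativization of a formula in negation normal form to the selector `i`: the variable
`n` is renamed to `2 * n + 1`, and each literal and each big disjunction gets the negated selector
as a further disjunct. -/
def relativize (i : ℕ) : PropFormula → PropFormula
  | var n => or (neg (sel i)) (var (2 * n + 1))
  | neg a => or (neg (sel i)) (neg (match a with | var n => var (2 * n + 1) | a => a))
  | and a b => and (relativize i a) (relativize i b)
  | or a b => or (relativize i a) (relativize i b)
  | bigAnd l => bigAnd (l.map fun a => relativize i a)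
  | bigOr l => bigOr (neg (sel i) :: l.map fun a => relativize i a)

theorem NNF.weft_relativize {a : PropFormula} (h : a.NNF) (i : ℕ) :
    (relativize i a).weft ≤ a.weft := by
  induction h with
  | var | neg => simp [relativize, weft, sel]
  | and _ _ h1 h2 | or _ _ h1 h2 =>
    simp only [relativize, weft]
    omega
  | @bigAnd l _ ih =>
    simp only [relativize, weft, add_le_add_iff_left]
    refine foldr_max_le.2 fun x hx => ?_
    obtain ⟨a, ha, rfl⟩ := List.mem_map.1 hx
    exact (ih a ha).trans (le_foldr_max ha)
  | @bigOr l _ ih =>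
    simp only [relativize, weft, add_le_add_iff_left]
    refine foldr_max_le.2 fun x hx => ?_
    rcases List.mem_cons.1 hx with rfl | hx
    · simp [weft, sel]
    · obtain ⟨a, ha, rfl⟩ := List.mem_map.1 hx
      exact (ih a ha).trans (le_foldr_max ha)

theorem NNF.depth_relativize {a : PropFormula} (h : a.NNF) (i : ℕ) :
    (relativize i a).depth ≤ a.depth + 1 := by
  induction h with
  | var | neg => simp [relativize, depth, sel]
  | and _ _ h1 h2 | or _ _ h1 h2 =>
    simp only [relativize, depth]
    omega
  | @bigAnd l _ ih =>
    simp only [relativize, depth, add_assoc, add_le_add_iff_left]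
    refine foldr_max_le.2 fun x hx => ?_
    obtain ⟨a, ha, rfl⟩ := List.mem_map.1 hx
    exact (ih a ha).trans (Nat.succ_le_succ (le_foldr_max ha))
  | @bigOr l _ ih =>
    simp only [relativize, depth, add_assoc, add_le_add_iff_left]
    refine foldr_max_le.2 fun x hx => ?_
    rcases List.mem_cons.1 hx with rfl | hx
    · simp [depth, sel]
    · obtain ⟨a, ha, rfl⟩ := List.mem_map.1 hx
      exact (ih a ha).trans (Nat.succ_le_succ (le_foldr_max ha))

/-- Selectors are even and renamed variables odd, so they never clash. -/
theorem two_mul_add_one_ne_two_pow (n i : ℕ) : 2 * n + 1 ≠ 2 ^ (i + 1) := by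
  rw [pow_succ]; omega

theorem NNF.mem_vars_relativize {a : PropFormula} (h : a.NNF) {i v : ℕ}
    (hv : v ∈ (relativize i a).vars) : v = 2 ^ (i + 1) ∨ ∃ n ∈ a.vars, v = 2 * n + 1 := by
  induction h with
  | var n | neg n => simpa [relativize, vars, sel] using hv
  | and _ _ h1 h2 | or _ _ h1 h2 =>
    simp only [relativize, vars, Finset.mem_union] at hv ⊢
    rcases hv with hv | hv
    · exact (h1 hv).imp_right fun ⟨n, hn, e⟩ => ⟨n, Or.inl hn, e⟩
    · exact (h2 hv).imp_right fun ⟨n, hn, e⟩ => ⟨n, Or.inr hn, e⟩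
  | bigAnd _ ih =>
    rw [relativize, mem_vars_bigAnd] at hv
    obtain ⟨_, hx, hv⟩ := hv
    obtain ⟨a, ha, rfl⟩ := List.mem_map.1 hx
    exact (ih a ha hv).imp_right fun ⟨n, hn, e⟩ => ⟨n, mem_vars_bigAnd.2 ⟨a, ha, hn⟩, e⟩
  | bigOr _ ih =>
    rw [relativize, mem_vars_bigOr] at hv
    obtain ⟨_, hx, hv⟩ := hv
    rcases List.mem_cons.1 hx with rfl | hx
    · left; simpa [vars, sel] using hv
    · obtain ⟨a, ha, rfl⟩ := List.mem_map.1 hx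
      exact (ih a ha hv).imp_right fun ⟨n, hn, e⟩ => ⟨n, mem_vars_bigOr.2 ⟨a, ha, hn⟩, e⟩

theorem NNF.vars_relativize {a : PropFormula} (h : a.NNF) (i : ℕ) {n : ℕ} (hn : n ∈ a.vars) :
    2 * n + 1 ∈ (relativize i a).vars := by
  induction h with
  | var m | neg m =>
    rw [show n = m by simpa [vars] using hn]
    simp [relativize, vars]
  | and _ _ h1 h2 | or _ _ h1 h2 =>
    simp only [relativize, vars, Finset.mem_union] at hn ⊢
    exact hn.imp h1 h2
  | bigAnd _ ih =>
    obtain ⟨a, ha, hn⟩ := mem_vars_bigAnd.1 hn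
    rw [relativize, mem_vars_bigAnd]
    exact ⟨_, List.mem_map_of_mem ha, ih a ha hn⟩
  | bigOr _ ih =>
    obtain ⟨a, ha, hn⟩ := mem_vars_bigOr.1 hn
    rw [relativize, mem_vars_bigOr]
    exact ⟨_, List.mem_cons_of_mem _ (List.mem_map_of_mem ha), ih a ha hn⟩

theorem NNF.sat_relativize {a : PropFormula} (h : a.NNF) {i : ℕ} {S S' : Finset ℕ}
    (hi : 2 ^ (i + 1) ∈ S') (hS : ∀ n, 2 * n + 1 ∈ S' ↔ n ∈ S) :
    (relativize i a).Sat S' ↔ a.Sat S := by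
  induction h with
  | var n | neg n => simp [relativize, Sat, sel, hi, hS]
  | and _ _ h1 h2 | or _ _ h1 h2 => simp [relativize, Sat, h1, h2]
  | bigAnd _ ih =>
    simp only [relativize, Sat, List.forall_mem_map]
    exact forall₂_congr ih
  | bigOr _ ih =>
    simp only [relativize, sat_bigOr, List.mem_cons, List.mem_map, exists_eq_or_imp,
      exists_exists_and_eq_and, Sat, sel, hi, not_true, false_or]
    exact exists_congr fun a => and_congr_right (ih a)

/-- All guards are true when the selector is false. The guard placed directly in a big disjunction
also covers disjunctions without members. -/
theorem sat_relativize_of_notMem {t d : ℕ} {a : PropFormula} (ha : a ∈ Delta t d) {i : ℕ}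
    {S : Finset ℕ} (hi : 2 ^ (i + 1) ∉ S) : (relativize i a).Sat S := by
  cases t with
  | zero =>
    rw [Delta] at ha
    obtain ⟨b, l, hb, hl, -, rfl⟩ := ha
    have hlit : ∀ c : PropFormula, c.IsLiteral → (relativize i c).Sat S := by
      rintro _ ⟨n, rfl | rfl⟩ <;> simp [relativize, Sat, sel, hi]
    refine foldl_induction (P := fun a => (relativize i a).Sat S) (fun a b ha _ => ?_)
      (hlit b hb) fun c hc => hlit c (hl c hc)
    rw [relativize, Sat]
    exact Or.inl ha
  | succ t =>
    rw [Delta] at ha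
    obtain ⟨l, -, rfl⟩ := ha
    rw [relativize, sat_bigOr]
    exact ⟨_, List.mem_cons_self, by simpa [Sat, sel] using hi⟩

/-- The formulas which say that the selector `i` excludes the selectors `j < i`. -/
def exclusions (i : ℕ) : List PropFormula :=
  (List.range i).reverse.map fun j => or (neg (sel j)) (neg (sel i))

/-- The members of the big conjunction which says that at most one selector is true and that the
member chosen by a selector is true, for the selectors from `i` on. -/
def constraints : ℕ → List (List PropFormula) → List PropFormula
  | _, [] => []
  | i, m :: ms => exclusions i ++ m.map (relativize i) ++ constraints (i + 1) ms

theorem mem_constraints {x : PropFormula} {i : ℕ} {ms : List (List PropFormula)} :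
    x ∈ constraints i ms ↔ ∃ (j : ℕ) (h : j < ms.length),
      x ∈ exclusions (i + j) ∨ ∃ a ∈ ms[j], x = relativize (i + j) a := by
  induction ms generalizing i with
  | nil => simp [constraints]
  | cons m ms ih =>
    simp only [constraints, List.mem_append, ih, List.mem_map]
    constructor
    · rintro ((h | ⟨a, ha, rfl⟩) | ⟨j, hj, h⟩)
      · exact ⟨0, by simp, Or.inl h⟩
      · exact ⟨0, by simp, Or.inr ⟨a, ha, rfl⟩⟩
      · refine ⟨j + 1, by simpa using hj, ?_⟩
        rw [add_right_comm, add_assoc] at h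
        simpa using h
    · rintro ⟨_ | j, hj, h⟩
      · left
        rcases h with h | ⟨a, ha, rfl⟩
        · exact Or.inl h
        · exact Or.inr ⟨a, ha, rfl⟩
      · refine Or.inr ⟨j, by simpa using hj, ?_⟩
        rw [add_right_comm, add_assoc]
        simpa using h

/-- The formula to which the big disjunction of the big conjunctions of the lists in `ms` is
reduced. -/
def reduct (ms : List (List PropFormula)) : PropFormula :=
  and (bigAnd (constraints 0 ms)) (bigOr ((List.range ms.length).reverse.map sel))

section Reduct

variable {t d : ℕ} {ms : List (List PropFormula)}

/-- The big conjunction has weft at most (t - 1) + 1. The big disjunction of selectors stands beside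
it under a small conjunction and has weft 1, which is where `1 ≤ t` enters. -/
theorem reduct_mem_Omega (ht : 1 ≤ t) (hms : ∀ m ∈ ms, ∀ a ∈ m, a ∈ Delta (t - 1) d) :
    reduct ms ∈ Omega t (t + d + 3) := by
  have h1 : ∀ x ∈ constraints 0 ms, x.weft ≤ t - 1 ∧ x.depth ≤ t + d := by
    intro x hx
    obtain ⟨j, hj, hx | ⟨a, ha, rfl⟩⟩ := mem_constraints.1 hx
    · obtain ⟨k, -, rfl⟩ := List.mem_map.1 hx
      simp [weft, depth, sel]
      omega
    · have ha := hms _ (List.getElem_mem hj) a ha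
      have hn := (nnf_of_mem _ _).2 a ha
      have h1 := hn.weft_relativize (0 + j)
      have h2 := hn.depth_relativize (0 + j)
      have h3 := (weft_depth_of_mem _ _).2 a ha
      omega
  have h2 := (foldr_max_le (f := weft)).2 fun x hx => (h1 x hx).1
  have h3 := (foldr_max_le (f := depth)).2 fun x hx => (h1 x hx).2
  have h4 : ∀ x ∈ (List.range ms.length).reverse.map sel, x.weft ≤ 0 ∧ x.depth ≤ 0 := by
    intro x hx
    obtain ⟨k, -, rfl⟩ := List.mem_map.1 hx
    simp [weft, depth, sel]
  have h5 := (foldr_max_le (f := weft)).2 fun x hx => (h4 x hx).1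
  have h6 := (foldr_max_le (f := depth)).2 fun x hx => (h4 x hx).2
  constructor
  · rw [reduct, weft, weft, weft]; omega
  · rw [reduct, depth, depth, depth]; omega

theorem mem_vars_blocks {v : ℕ} :
    v ∈ (bigOr (ms.map bigAnd)).vars ↔ ∃ m ∈ ms, ∃ a ∈ m, v ∈ a.vars := by
  simp [mem_vars_bigOr, mem_vars_bigAnd]

theorem sel_mem_vars_reduct {i : ℕ} (hi : i < ms.length) : 2 ^ (i + 1) ∈ (reduct ms).vars := by
  rw [reduct, vars, Finset.mem_union, mem_vars_bigOr]
  exact Or.inr ⟨sel i, by simpa using ⟨i, hi, rfl⟩, by simp [sel, vars]⟩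

/-- Weights refer to the occurring variables, so those of unselected disjuncts must survive the
reduction too. -/
theorem mem_vars_reduct (hms : ∀ m ∈ ms, ∀ a ∈ m, a.NNF) {v : ℕ} :
    v ∈ (reduct ms).vars ↔ (∃ i < ms.length, v = 2 ^ (i + 1)) ∨
      ∃ n ∈ (bigOr (ms.map bigAnd)).vars, v = 2 * n + 1 := by
  constructor
  · intro hv
    rw [reduct, vars, Finset.mem_union, mem_vars_bigOr, mem_vars_bigAnd] at hv
    rcases hv with ⟨x, hx, hv⟩ | ⟨x, hx, hv⟩
    · obtain ⟨j, hj, hx | ⟨a, ha, rfl⟩⟩ := mem_constraints.1 hx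
      · obtain ⟨k, hk, rfl⟩ := List.mem_map.1 hx
        simp only [vars, sel, Finset.mem_union, Finset.mem_singleton] at hv
        simp only [zero_add, List.mem_reverse, List.mem_range] at hk hv
        rcases hv with rfl | rfl
        · exact Or.inl ⟨k, by omega, rfl⟩
        · exact Or.inl ⟨j, hj, rfl⟩
      · rcases (hms _ (List.getElem_mem hj) a ha).mem_vars_relativize hv with rfl | ⟨n, hn, rfl⟩
        · exact Or.inl ⟨j, hj, by rw [zero_add]⟩
        · exact Or.inr ⟨n, mem_vars_blocks.2 ⟨_, List.getElem_mem hj, a, ha, hn⟩, rfl⟩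
    · obtain ⟨i, hi, rfl⟩ := List.mem_map.1 hx
      exact Or.inl ⟨i, by simpa using hi, by simpa [sel, vars] using hv⟩
  · rintro (⟨i, hi, rfl⟩ | ⟨n, hn, rfl⟩)
    · exact sel_mem_vars_reduct hi
    · obtain ⟨m, hm, a, ha, hn⟩ := mem_vars_blocks.1 hn
      obtain ⟨j, hj, rfl⟩ := List.mem_iff_getElem.1 hm
      rw [reduct, vars, Finset.mem_union, mem_vars_bigAnd]
      exact Or.inl ⟨_, mem_constraints.2 ⟨j, hj, Or.inr ⟨a, ha, rfl⟩⟩,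
        (hms _ hm a ha).vars_relativize _ hn⟩

theorem sat_reduct {S : Finset ℕ} : (reduct ms).Sat S ↔
    (∀ i j, j < i → i < ms.length → 2 ^ (i + 1) ∈ S → 2 ^ (j + 1) ∉ S) ∧
    (∀ (i : ℕ) (hi : i < ms.length), ∀ a ∈ ms[i], (relativize i a).Sat S) ∧
    ∃ i < ms.length, 2 ^ (i + 1) ∈ S := by
  have h1 : (∀ x ∈ constraints 0 ms, x.Sat S) ↔
      (∀ i j, j < i → i < ms.length → 2 ^ (i + 1) ∈ S → 2 ^ (j + 1) ∉ S) ∧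
      (∀ (i : ℕ) (hi : i < ms.length), ∀ a ∈ ms[i], (relativize i a).Sat S) := by
    constructor
    · intro h
      refine ⟨fun i j hji hi hiS hjS => ?_, fun i hi a ha =>
        h _ (mem_constraints.2 ⟨i, hi, Or.inr ⟨a, ha, by rw [zero_add]⟩⟩)⟩
      have := h (or (neg (sel j)) (neg (sel i)))
        (mem_constraints.2 ⟨i, hi, Or.inl (by simpa [exclusions] using ⟨j, hji, rfl⟩)⟩)
      simp [Sat, sel, hiS, hjS] at this
    · rintro ⟨h1, h2⟩ x hx
      obtain ⟨i, hi, hx | ⟨a, ha, rfl⟩⟩ := mem_constraints.1 hx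
      · obtain ⟨j, hj, rfl⟩ := List.mem_map.1 hx
        simp only [zero_add, List.mem_reverse, List.mem_range] at hj
        have := h1 i j hj hi
        simp only [Sat, sel, zero_add]
        tauto
      · rw [zero_add]
        exact h2 i hi a ha
  rw [reduct, Sat, Sat, sat_bigOr, h1, and_assoc]
  simp [Sat, sel]

/-- Assignments correspond by S' = {2 ^ (i + 1)} ∪ {2n + 1 | n ∈ S}, where i is a disjunct that S
satisfies. -/
theorem kSat_reduct (hms : ∀ m ∈ ms, ∀ a ∈ m, a ∈ Delta t d) (k : ℕ) :
    (reduct ms).KSat (k + 1) ↔ (bigOr (ms.map bigAnd)).KSat k := by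
  have hnnf : ∀ m ∈ ms, ∀ a ∈ m, a.NNF := fun m hm a ha => (nnf_of_mem t d).2 a (hms m hm a ha)
  have hinj : Function.Injective fun n : ℕ => 2 * n + 1 := fun a b h => by simpa using h
  have hcard : ∀ (i : ℕ) (S : Finset ℕ),
      (insert (2 ^ (i + 1)) (S.image fun n => 2 * n + 1)).card = S.card + 1 := by
    intro i S
    rw [Finset.card_insert_of_notMem, Finset.card_image_of_injective _ hinj]
    simp only [Finset.mem_image, not_exists, not_and]
    exact fun n _ => two_mul_add_one_ne_two_pow n i
  have hmem : ∀ (i : ℕ) (S : Finset ℕ) (n : ℕ),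
      2 * n + 1 ∈ insert (2 ^ (i + 1)) (S.image fun n => 2 * n + 1) ↔ n ∈ S := by
    intro i S n
    simp [two_mul_add_one_ne_two_pow n i]
  constructor
  · rintro ⟨S', hS', hc, hsat⟩
    obtain ⟨h1, h2, i, hi, hiS⟩ := sat_reduct.1 hsat
    let S := (bigOr (ms.map bigAnd)).vars.filter fun n => 2 * n + 1 ∈ S'
    -- The exclusions leave i as the only true selector, so it accounts for exactly one unit of
    -- weight.
    have hS : S' = insert (2 ^ (i + 1)) (S.image fun n => 2 * n + 1) := by
      ext v
      simp only [Finset.mem_insert, Finset.mem_image, S, Finset.mem_filter]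
      constructor
      · intro hv
        rcases (mem_vars_reduct hnnf).1 (hS' hv) with ⟨j, hj, rfl⟩ | ⟨n, hn, rfl⟩
        · rcases lt_trichotomy i j with h | rfl | h
          · exact absurd hiS (h1 j i h hj hv)
          · exact Or.inl rfl
          · exact absurd hv (h1 i j h hi hiS)
        · exact Or.inr ⟨n, ⟨hn, hv⟩, rfl⟩
      · rintro (rfl | ⟨n, ⟨-, hn⟩, rfl⟩)
        · exact hiS
        · exact hn
    refine ⟨S, Finset.filter_subset _ _, ?_, ?_⟩
    · rw [hS, hcard] at hc
      omega
    · rw [sat_bigOr]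
      refine ⟨_, List.mem_map_of_mem (List.getElem_mem hi), ?_⟩
      rw [Sat]
      intro a ha
      refine ((hnnf _ (List.getElem_mem hi) a ha).sat_relativize hiS fun n => ?_).1 (h2 i hi a ha)
      rw [hS, hmem]
  · rintro ⟨S, hS, hc, hsat⟩
    obtain ⟨x, hx, hsat⟩ := sat_bigOr.1 hsat
    obtain ⟨m, hm, rfl⟩ := List.mem_map.1 hx
    obtain ⟨i, hi, rfl⟩ := List.mem_iff_getElem.1 hm
    rw [Sat] at hsat
    have hsel : ∀ j, 2 ^ (j + 1) ∈ insert (2 ^ (i + 1)) (S.image fun n => 2 * n + 1) → j = i := by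
      intro j hj
      rcases Finset.mem_insert.1 hj with h | h
      · have := Nat.pow_right_injective le_rfl h
        omega
      · obtain ⟨n, -, h⟩ := Finset.mem_image.1 h
        exact absurd h (two_mul_add_one_ne_two_pow n j)
    refine ⟨insert (2 ^ (i + 1)) (S.image fun n => 2 * n + 1), ?_, by rw [hcard, hc],
      sat_reduct.2 ⟨?_, ?_, i, hi, by simp⟩⟩
    · intro v hv
      rw [mem_vars_reduct hnnf]
      rcases Finset.mem_insert.1 hv with rfl | hv
      · exact Or.inl ⟨i, hi, rfl⟩
      · obtain ⟨n, hn, rfl⟩ := Finset.mem_image.1 hv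
        exact Or.inr ⟨n, hS hn, rfl⟩
    · intro j l hlj _ hj hl
      have := hsel j hj
      have := hsel l hl
      omega
    · intro j hj a ha
      by_cases hji : j = i
      · subst hji
        exact ((hnnf _ hm a ha).sat_relativize (by simp) (hmem _ S)).2 (hsat a ha)
      · exact sat_relativize_of_notMem (hms _ (List.getElem_mem hj) a ha)
          fun h => hji (hsel j h)

end Reduct

theorem exists_blocks {t d : ℕ} (ht : 1 ≤ t) {a : PropFormula} (ha : a ∈ Delta (t + 1) d) :
    ∃ ms : List (List PropFormula), a = bigOr (ms.map bigAnd) ∧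
      ∀ m ∈ ms, ∀ b ∈ m, b ∈ Delta (t - 1) d := by
  obtain ⟨t, rfl⟩ := Nat.exists_eq_add_of_le' ht
  rw [Delta] at ha
  obtain ⟨l, hl, rfl⟩ := ha
  rw [Gamma] at hl
  induction l with
  | nil => exact ⟨[], by simp⟩
  | cons c l ih =>
    obtain ⟨ms, h, hms⟩ := ih fun c hc => hl c (by simp [hc])
    obtain ⟨m, hm, rfl⟩ := hl c (by simp)
    rw [bigOr.injEq] at h
    exact ⟨m :: ms, by simp [h], by simpa using ⟨hm, hms⟩⟩

end PropFormula

end FPT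

-- The reduction on words, as a one-pass translation.

namespace FPT

open PropFormula

/-- The state of the translation of words: the enclosing big connectives that are still open
(`bigOr` for the outermost one, `bigAnd` for a member of it, `close` for the others), the number of
members that have been closed, whether the last symbol was a negation, and the carry of the addition
of one to the parameter. -/
structure TransState where
  frames : List (Sym ⊕ Bool)
  idx : ℕ
  neg : Bool
  carry : Bool

namespace TransState

/-- The word for the selector `i`. -/
def selWord (i : ℕ) : List (Sym ⊕ Bool) := (sel i).encode.map Sum.inl

/-- The word for the negated selector `i`. -/
def negSelWord (i : ℕ) : List (Sym ⊕ Bool) := Sum.inl .neg :: selWord i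

/-- The word for the exclusions between the selector `i` and the selectors below `j`. -/
def exclWord (i j : ℕ) : List (Sym ⊕ Bool) :=
  (List.range j).reverse.flatMap fun l => Sum.inl .or :: (negSelWord l ++ negSelWord i)

/-- The word for the selectors below `j`. -/
def selsWord (j : ℕ) : List (Sym ⊕ Bool) := (List.range j).reverse.flatMap selWord

/-- The state after reading a symbol. -/
def next (s : TransState) : Sym ⊕ Bool → TransState
  | .inl .bigOr =>
    { s with frames := (if s.frames = [] then .inl .bigOr else .inl .close) :: s.frames }
  | .inl .bigAnd =>
    { s with frames := (if s.frames.head? = some (.inl .bigOr) then .inl .bigAnd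
        else .inl .close) :: s.frames }
  | .inl .close =>
    { s with
      frames := s.frames.tail
      idx := if s.frames.head? = some (.inl .bigAnd) then s.idx + 1 else s.idx }
  | .inl .neg => { s with neg := true }
  | .inl .var => { s with neg := false }
  | .inl _ => s
  | .inr b => { s with carry := s.carry && b }

/-- The word that is written on reading a symbol. -/
def write (s : TransState) : Sym ⊕ Bool → List (Sym ⊕ Bool)
  | .inl .bigOr =>
    if s.frames = [] then [.inl .and, .inl .bigAnd] else .inl .bigOr :: negSelWord s.idx
  | .inl .bigAnd =>
    if s.frames.head? = some (.inl .bigOr) then exclWord s.idx s.idx else [.inl .bigAnd]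
  | .inl .close =>
    if s.frames.head? = some (.inl .bigOr) then
      .inl .close :: .inl .bigOr :: (selsWord s.idx ++ [.inl .close])
    else if s.frames.head? = some (.inl .bigAnd) then [] else [.inl .close]
  | .inl .neg => .inl .or :: (negSelWord s.idx ++ [.inl .neg])
  | .inl .var =>
    if s.neg then [.inl .var, .inl .one]
    else .inl .or :: (negSelWord s.idx ++ [.inl .var, .inl .one])
  | .inl c => [.inl c]
  | .inr b => [.inr (s.carry ^^ b)]

/-- The state after reading a word, and the word that is written. -/
def run : TransState → List (Sym ⊕ Bool) → TransState × List (Sym ⊕ Bool)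
  | s, [] => (s, [])
  | s, c :: w => ((run (s.next c) w).1, s.write c ++ (run (s.next c) w).2)

theorem run_append (s : TransState) (u v : List (Sym ⊕ Bool)) :
    s.run (u ++ v) = (((s.run u).1.run v).1, (s.run u).2 ++ ((s.run u).1.run v).2) := by
  induction u generalizing s with
  | nil => simp [run]
  | cons c u ih => simp [run, ih]

theorem run_append_of {s s' s'' : TransState} {u v u' v' : List (Sym ⊕ Bool)}
    (h1 : s.run u = (s', u')) (h2 : s'.run v = (s'', v')) : s.run (u ++ v) = (s'', u' ++ v') := by
  rw [run_append, h1, h2]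

theorem run_cons_of {s s' s'' : TransState} {c : Sym ⊕ Bool} {v u' v' : List (Sym ⊕ Bool)}
    (h1 : s.next c = s') (h1' : s.write c = u') (h2 : s'.run v = (s'', v')) :
    s.run (c :: v) = (s'', u' ++ v') := by
  rw [run, h1, h1', h2]

theorem run_digits (s : TransState) (l : List Bool) :
    s.run ((l.map fun b => if b then Sym.one else Sym.zero).map Sum.inl) =
      (s, (l.map fun b => if b then Sym.one else Sym.zero).map Sum.inl) := by
  induction l with
  | nil => rfl
  | cons b l ih => cases b <;> exact run_cons_of rfl rfl ih

theorem run_flatten {s : TransState} {f : PropFormula → PropFormula} {l : List PropFormula}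
    (h : ∀ a ∈ l, s.run (a.encode.map Sum.inl) = (s, (f a).encode.map Sum.inl)) :
    s.run ((l.map fun a => a.encode).flatten.map Sum.inl) =
      (s, ((l.map f).map fun a => a.encode).flatten.map Sum.inl) := by
  induction l with
  | nil => rfl
  | cons a l ih =>
    simp only [List.map_cons, List.flatten_cons, List.map_append]
    exact run_append_of (h a (by simp)) (ih fun a ha => h a (by simp [ha]))

/-- With the least significant digit first, renaming n to 2n + 1 only inserts a digit one before the
old digits. -/
theorem map_inl_encode_var (n : ℕ) : (PropFormula.var (2 * n + 1)).encode.map Sum.inl =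
    (.inl .var :: .inl .one :: (n.bits.map fun b => if b then Sym.one else Sym.zero).map Sum.inl :
      List (Sym ⊕ Bool)) := by
  simp [encode, Nat.bit1_bits]

/-- Inside a member the state is restored after each subformula. The frame `g` keeps a nested big
disjunction from being taken for the outermost one, and `hg` keeps a nested big conjunction from
being taken for a new member. -/
theorem run_encode {a : PropFormula} (h : a.NNF) (g : Sym ⊕ Bool) (hg : g ≠ .inl .bigOr)
    (F : List (Sym ⊕ Bool)) (i : ℕ) (c : Bool) :
    run ⟨g :: F, i, false, c⟩ (a.encode.map Sum.inl) =
      (⟨g :: F, i, false, c⟩, (relativize i a).encode.map Sum.inl) := by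
  induction h generalizing g F with
  | var n =>
    have h := run_cons_of (s := ⟨g :: F, i, false, c⟩) (c := .inl .var) rfl rfl
      (run_digits _ n.bits)
    rw [encode, List.map_cons, h, relativize, encode, encode]
    simp [negSelWord, selWord, next, write, encode]
  | neg n =>
    have h := run_cons_of (s := ⟨g :: F, i, false, c⟩) (c := .inl .neg) rfl rfl
      (run_cons_of (c := .inl .var) rfl rfl (run_digits _ n.bits))
    rw [encode, encode, List.map_cons, List.map_cons, h, relativize, encode, encode, encode]
    simp [map_inl_encode_var, negSelWord, selWord, next, write]
  | and _ _ h1 h2 =>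
    simp only [relativize, encode, List.map_cons, List.map_append]
    exact run_cons_of rfl rfl (run_append_of (h1 g hg F) (h2 g hg F))
  | or _ _ h1 h2 =>
    simp only [relativize, encode, List.map_cons, List.map_append]
    exact run_cons_of rfl rfl (run_append_of (h1 g hg F) (h2 g hg F))
  | bigAnd _ ih =>
    simp only [relativize, encode, List.map_cons, List.map_append]
    refine run_cons_of (s' := ⟨.inl .close :: g :: F, i, false, c⟩) (u' := [.inl .bigAnd])
      (by simp [next, hg]) (by simp [write, hg])
      (run_append_of (run_flatten fun a ha => ih a ha _ (by simp) _) ?_)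
    simp [run, next, write]
  | bigOr _ ih =>
    simp only [relativize, encode, List.map_cons, List.map_append, List.flatten_cons]
    refine (run_cons_of (s' := ⟨.inl .close :: g :: F, i, false, c⟩)
      (u' := .inl .bigOr :: negSelWord i) (by simp [next]) (by simp [write])
      (run_append_of (run_flatten fun a ha => ih a ha _ (by simp) _)
        (s'' := ⟨g :: F, i, false, c⟩) (v' := [.inl .close]) ?_)).trans ?_
    · simp [run, next, write]
    · simp [negSelWord, selWord]

theorem exclWord_eq (i : ℕ) :
    exclWord i i = ((exclusions i).map fun a => a.encode).flatten.map Sum.inl := by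
  simp [exclWord, exclusions, List.flatMap, List.map_flatten, Function.comp_def, encode,
    negSelWord, selWord]

theorem selsWord_eq (i : ℕ) :
    selsWord i = (((List.range i).reverse.map sel).map fun a => a.encode).flatten.map Sum.inl := by
  simp [selsWord, List.flatMap, List.map_flatten, Function.comp_def]
  rfl

theorem run_blocks {ms : List (List PropFormula)} (h : ∀ m ∈ ms, ∀ a ∈ m, a.NNF) (i : ℕ)
    (c : Bool) :
    run ⟨[.inl .bigOr], i, false, c⟩
      (((ms.map PropFormula.bigAnd).map fun a => a.encode).flatten.map Sum.inl) =
      (⟨[.inl .bigOr], i + ms.length, false, c⟩,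
        ((constraints i ms).map fun a => a.encode).flatten.map Sum.inl) := by
  induction ms generalizing i with
  | nil => rfl
  | cons m ms ih =>
    have h1 := run_flatten (s := ⟨[.inl .bigAnd, .inl .bigOr], i, false, c⟩) (l := m)
      fun a ha => run_encode (h m (by simp) a ha) _ (by simp) _ _ _
    have h2 := ih (fun m hm => h m (by simp [hm])) (i + 1)
    simp only [List.map_cons, List.flatten_cons, List.map_append, constraints, encode,
      List.flatten_append, List.length_cons]
    rw [List.cons_append, List.append_assoc, List.append_assoc, ← exclWord_eq,
      show i + (ms.length + 1) = i + 1 + ms.length by omega]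
    refine run_cons_of (by simp [next]) (by simp [write]) (run_append_of h1 ?_)
    -- The symbol that closes a member writes nothing: all members are merged into a single big
    -- conjunction.
    rw [← List.nil_append (List.map _ (List.map _ (constraints _ _)).flatten)]
    exact run_cons_of (by simp [next]) (by simp [write]) h2

theorem run_bigOr {ms : List (List PropFormula)} (h : ∀ m ∈ ms, ∀ a ∈ m, a.NNF) (c : Bool) :
    run ⟨[], 0, false, c⟩ ((PropFormula.bigOr (ms.map PropFormula.bigAnd)).encode.map Sum.inl) =
      (⟨[], ms.length, false, c⟩, (reduct ms).encode.map Sum.inl) := by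
  simp only [reduct, encode, List.map_cons, List.map_append]
  refine (run_cons_of (s' := ⟨[.inl .bigOr], 0, false, c⟩) (u' := [.inl .and, .inl .bigAnd])
    (by simp [next]) (by simp [write]) (run_append_of (run_blocks h 0 c)
    (s'' := ⟨[], ms.length, false, c⟩)
    (v' := .inl .close :: .inl .bigOr :: (selsWord ms.length ++ [.inl .close])) ?_)).trans ?_
  · simp [run, next, write]
  · simp [selsWord_eq]

theorem run_bits_false (F : List (Sym ⊕ Bool)) (i : ℕ) (b : Bool) (l : List Bool) :
    run ⟨F, i, b, false⟩ (l.map Sum.inr) = (⟨F, i, b, false⟩, l.map Sum.inr) := by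
  induction l with
  | nil => rfl
  | cons x l ih =>
    have h1 : next ⟨F, i, b, false⟩ (.inr x) = ⟨F, i, b, false⟩ := by simp [next]
    have h2 : write ⟨F, i, b, false⟩ (.inr x) = [.inr x] := by simp [write]
    exact run_cons_of h1 h2 ih

/-- The digits that have to be appended in a final state. -/
def carryWord (s : TransState) : List (Sym ⊕ Bool) := if s.carry then [.inr true] else []

/-- Addition of one by a rippling carry; a carry that survives the last digit becomes a new leading
digit. -/
theorem run_bits (F : List (Sym ⊕ Bool)) (i : ℕ) (b : Bool) (k : ℕ) :
    (run ⟨F, i, b, true⟩ (k.bits.map Sum.inr)).2 ++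
      (run ⟨F, i, b, true⟩ (k.bits.map Sum.inr)).1.carryWord = (k + 1).bits.map Sum.inr := by
  induction k using Nat.binaryRec' with
  | zero => simp [run, carryWord]
  | bit x n hn ih =>
    rw [Nat.bits_append_bit _ _ hn, List.map_cons]
    cases x with
    | false =>
      have h := run_cons_of (s := ⟨F, i, b, true⟩) (c := .inr false) rfl rfl
        (run_bits_false F i b n.bits)
      rw [h]
      rw [show Nat.bit false n + 1 = 2 * n + 1 by simp [Nat.bit], Nat.bit1_bits]
      simp [write, carryWord]
    | true =>
      rw [show Nat.bit true n + 1 = 2 * (n + 1) by simp [Nat.bit]; ring,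
        Nat.bit0_bits _ (Nat.succ_ne_zero n), List.map_cons, ← ih]
      rfl

theorem run_instance {ms : List (List PropFormula)} (h : ∀ m ∈ ms, ∀ a ∈ m, a.NNF) (k : ℕ)
    {w : List (Sym ⊕ Bool)}
    (hw : w = pairWord ((PropFormula.bigOr (ms.map PropFormula.bigAnd)).encode, k.bits)) :
    (run ⟨[], 0, false, true⟩ w).2 ++ (run ⟨[], 0, false, true⟩ w).1.carryWord =
      pairWord ((reduct ms).encode, (k + 1).bits) := by
  subst hw
  simp only [pairWord]
  rw [run_append, run_bigOr h, ← run_bits [] ms.length false k, List.append_assoc]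

end TransState

end FPT

-- The translation as a stack program, with time bounds.

namespace FPT

namespace Prog

variable {K Γ S : Type} [DecidableEq K]

/-- `Exec` with an upper bound on the number of steps. -/
def Runs (p : Prog K Γ S) (s : S) (T : K → List Γ) (N : ℕ) (s' : S) (T' : K → List Γ) : Prop :=
  ∃ n ≤ N, Exec p s T n s' T'

namespace Runs

variable {p q : Prog K Γ S} {s s' s'' : S} {T T' T'' : K → List Γ} {N M : ℕ} {k : K}

theorem mono (h : Runs p s T N s' T') (hN : N ≤ M) : Runs p s T M s' T' :=
  h.imp fun _ ⟨h1, h2⟩ => ⟨h1.trans hN, h2⟩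

theorem seq (h1 : Runs p s T N s' T') (h2 : Runs q s' T' M s'' T'') :
    Runs (p.seq q) s T (N + M) s'' T'' := by
  obtain ⟨n, hn, h1⟩ := h1
  obtain ⟨m, hm, h2⟩ := h2
  exact ⟨n + m, by omega, .seq h1 h2⟩

theorem set (f : S → S) : Runs (.set f) s T 1 (f s) T := ⟨1, le_rfl, .set f s T⟩

theorem push {a : Γ} (h : Function.update T k (a :: T k) = T') : Runs (.push k a) s T 1 s T' :=
  h ▸ ⟨1, le_rfl, .push k a s T⟩

theorem cases {p : S → Prog K Γ S} (h : Runs (p s) s T N s' T') :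
    Runs (.cases p) s T (1 + N) s' T' := by
  obtain ⟨n, hn, h⟩ := h
  exact ⟨1 + n, by omega, .cases h⟩

theorem popCases {p : Option Γ → Prog K Γ S}
    (h : Runs (p (T k).head?) s (Function.update T k (T k).tail) N s' T') :
    Runs (.popCases k p) s T (1 + N) s' T' := by
  obtain ⟨n, hn, h⟩ := h
  exact ⟨1 + n, by omega, .popCases h⟩

theorem forPop_nil {p : Γ → Prog K Γ S} (h : T k = []) : Runs (.forPop k p) s T 1 s T :=
  ⟨1, le_rfl, .forPop_nil h⟩

theorem forPop_cons {p : Γ → Prog K Γ S} {a : Γ} {w : List Γ} (h : T k = a :: w)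
    (h1 : Runs (p a) s (Function.update T k w) N s' T') (h2 : Runs (.forPop k p) s' T' M s'' T'') :
    Runs (.forPop k p) s T (1 + N + M) s'' T'' := by
  obtain ⟨n, hn, h1⟩ := h1
  obtain ⟨m, hm, h2⟩ := h2
  exact ⟨1 + n + m, by omega, .forPop_cons h h1 h2⟩

/-- A loop that is controlled by a counter. -/
theorem forPop_count {p : Γ → Prog K Γ S} (T : ℕ → K → List Γ) (h0 : T 0 k = []) (n : ℕ)
    (h : ∀ j < n, ∃ a w, T (j + 1) k = a :: w ∧
      Runs (p a) s (Function.update (T (j + 1)) k w) M s (T j)) :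
    Runs (.forPop k p) s (T n) (n * (M + 1) + 1) s (T 0) := by
  induction n with
  | zero => exact (forPop_nil h0).mono (by omega)
  | succ n ih =>
    obtain ⟨a, w, h1, h2⟩ := h n (by omega)
    exact (forPop_cons h1 h2 (ih fun j hj => h j (by omega))).mono (by
      rw [Nat.succ_mul]; omega)

end Runs

end Prog

open Prog

/-- The stacks of the machine: input and output, translated word, counter, copy of the counter,
auxiliary stack, and open connectives. -/
inductive Stack : Type
  | inp | out | cnt | aux | tmp | frm
  deriving DecidableEq

namespace Stack

instance : Fintype Stack where
  elems := {.inp, .out, .cnt, .aux, .tmp, .frm}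
  complete s := by cases s <;> decide

variable {Γ : Type}

/-- The contents of all stacks. -/
def all (a b c d e f : List Γ) : Stack → List Γ
  | inp => a
  | out => b
  | cnt => c
  | aux => d
  | tmp => e
  | frm => f

variable (a b c d e f x : List Γ)

@[simp] theorem all_inp : all a b c d e f inp = a := rfl
@[simp] theorem all_out : all a b c d e f out = b := rfl
@[simp] theorem all_cnt : all a b c d e f cnt = c := rfl
@[simp] theorem all_aux : all a b c d e f aux = d := rfl
@[simp] theorem all_tmp : all a b c d e f tmp = e := rfl
@[simp] theorem all_frm : all a b c d e f frm = f := rfl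

@[simp] theorem update_inp : Function.update (all a b c d e f) inp x = all x b c d e f := by
  funext k; cases k <;> rfl
@[simp] theorem update_out : Function.update (all a b c d e f) out x = all a x c d e f := by
  funext k; cases k <;> rfl
@[simp] theorem update_cnt : Function.update (all a b c d e f) cnt x = all a b x d e f := by
  funext k; cases k <;> rfl
@[simp] theorem update_aux : Function.update (all a b c d e f) aux x = all a b c x e f := by
  funext k; cases k <;> rfl
@[simp] theorem update_tmp : Function.update (all a b c d e f) tmp x = all a b c d x f := by
  funext k; cases k <;> rfl
@[simp] theorem update_frm : Function.update (all a b c d e f) frm x = all a b c d e x := by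
  funext k; cases k <;> rfl

theorem all_input : all a [] [] [] [] [] = Function.update (fun _ => []) inp a := by
  funext k; cases k <;> rfl

end Stack

namespace Trans

open TransState Stack

variable {S : Type}

/-- The stack content that represents the number `n`. -/
def marks (n : ℕ) : List (Sym ⊕ Bool) := List.replicate n (.inl .one)

theorem marks_succ (n : ℕ) : marks (n + 1) = .inl .one :: marks n := rfl

/-! The effect of pushing a symbol to the individual stacks. -/

section

variable (s : S) (a b c d e f : List (Sym ⊕ Bool)) (x : Sym ⊕ Bool)

theorem runs_push_inp :
    Runs (.push inp x) s (all a b c d e f) 1 s (all (x :: a) b c d e f) :=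
  Runs.push (by simp)

theorem runs_push_out :
    Runs (.push out x) s (all a b c d e f) 1 s (all a (x :: b) c d e f) :=
  Runs.push (by simp)

theorem runs_push_frm :
    Runs (.push frm x) s (all a b c d e f) 1 s (all a b c d e (x :: f)) :=
  Runs.push (by simp)

end

/-- Writes a word to the translated word. -/
def emit : List (Sym ⊕ Bool) → Prog Stack (Sym ⊕ Bool) S
  | [] => .set id
  | a :: w => .seq (.push out a) (emit w)

/-- Writes the selector whose number is on the stack `k`. -/
def emitSel (k : Stack) : Prog Stack (Sym ⊕ Bool) S :=
  .seq (emit [.inl .var, .inl .zero])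
    (.seq (.forPop k fun _ => .seq (.push tmp (.inl .one)) (.push out (.inl .zero)))
      (.seq (.forPop tmp fun _ => .push k (.inl .one)) (.push out (.inl .one))))

/-- Writes the negated selector whose number is on the stack `k`. -/
def emitNegSel (k : Stack) : Prog Stack (Sym ⊕ Bool) S :=
  .seq (.push out (.inl .neg)) (emitSel k)

/-- Copies the counter. -/
def copyCount : Prog Stack (Sym ⊕ Bool) S :=
  .seq (.forPop cnt fun _ => .push tmp (.inl .one))
    (.forPop tmp fun _ => .seq (.push cnt (.inl .one)) (.push aux (.inl .one)))

/-- Writes the exclusions for the current selector. -/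
def emitExcl : Prog Stack (Sym ⊕ Bool) S :=
  .seq copyCount (.forPop aux fun _ =>
    .seq (.push out (.inl .or)) (.seq (emitNegSel aux) (emitNegSel cnt)))

/-- Writes all selectors below the current one. -/
def emitSels : Prog Stack (Sym ⊕ Bool) S :=
  .seq copyCount (.forPop aux fun _ => emitSel aux)

section

variable (s : S) (a b f : List (Sym ⊕ Bool)) (i j : ℕ)

theorem runs_emit (d : List (Sym ⊕ Bool)) (f w c e : List (Sym ⊕ Bool)) :
    Runs (emit w) s (all a b c d e f) (w.length + 1) s (all a (w.reverse ++ b) c d e f) := by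
  induction w generalizing b with
  | nil => exact Runs.set id
  | cons x w ih =>
    have := (runs_push_out s _ _ _ _ _ _ _).seq (ih (x :: b))
    rw [List.reverse_cons, List.append_assoc]
    exact this.mono (by rw [List.length_cons]; omega)

/-- The index 2 ^ (i + 1) is i + 1 zeros followed by a one, so a unary counter suffices to write it.
The reversal reflects that the output stack is filled from the bottom. -/
theorem selWord_reverse : (selWord i).reverse =
    [.inl .one] ++ (List.replicate i (.inl .zero) ++ [.inl .zero, .inl .var]) := by
  have h : ∀ n, (2 ^ n).bits = List.replicate n false ++ [true] := by
    intro n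
    induction n with
    | zero => simp
    | succ n ih =>
      rw [pow_succ, mul_comm, Nat.bit0_bits _ (by positivity), ih]
      rfl
  simp [selWord, PropFormula.sel, PropFormula.encode, h, List.replicate_succ]

theorem runs_emitSel_cnt (d : List (Sym ⊕ Bool)) :
    Runs (emitSel cnt) s (all a b (marks i) d [] f) (5 * i + 6) s
      (all a ((selWord i).reverse ++ b) (marks i) d [] f) := by
  have h1 := runs_emit s a b d f [.inl .var, .inl .zero] (marks i) []
  have h2 := Runs.forPop_count (s := s) (M := 2) (k := cnt)
    (p := fun _ => .seq (.push tmp (.inl .one)) (.push out (.inl .zero)))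
    -- Loop invariant with j marks left: the i - j processed marks are saved on `tmp`, from which
    -- the next loop restores the counter.
    (fun j => all a (List.replicate (i - j) (.inl .zero) ++ ([.inl .var, .inl .zero].reverse ++ b)) (marks j) d (marks (i - j)) f)
    rfl i
    fun j hj => ⟨_, marks j, rfl, by
      obtain ⟨l, hl⟩ : ∃ l, i - j = l + 1 := ⟨i - j - 1, by omega⟩
      rw [show i - (j + 1) = l by omega, hl]
      exact (Runs.push (by simp; rfl)).seq (Runs.push (by simp [List.replicate_succ, marks_succ]))⟩
  have h3 := Runs.forPop_count (s := s) (M := 1) (k := tmp)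
    (p := fun _ => .push cnt (.inl .one))
    (fun j => all a (List.replicate i (.inl .zero) ++ ([.inl .var, .inl .zero].reverse ++ b)) (marks (i - j)) d (marks j) f)
    rfl i
    fun j hj => ⟨_, marks j, rfl, Runs.push (by
      obtain ⟨l, hl⟩ : ∃ l, i - j = l + 1 := ⟨i - j - 1, by omega⟩
      rw [show i - (j + 1) = l by omega, hl]
      simp [marks_succ])⟩
  simp only [Nat.sub_self, Nat.sub_zero] at h2 h3
  refine (h1.seq (h2.seq (h3.seq (Runs.push (k := out) (a := .inl .one) ?_)))).mono ?_
  · simp [selWord_reverse, marks]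
  · simp; omega

theorem runs_emitSel_aux (c : List (Sym ⊕ Bool)) :
    Runs (emitSel aux) s (all a b c (marks i) [] f) (5 * i + 6) s
      (all a ((selWord i).reverse ++ b) c (marks i) [] f) := by
  have h1 := runs_emit s a b (marks i) f [.inl .var, .inl .zero] c []
  have h2 := Runs.forPop_count (s := s) (M := 2) (k := aux)
    (p := fun _ => .seq (.push tmp (.inl .one)) (.push out (.inl .zero)))
    (fun j => all a (List.replicate (i - j) (.inl .zero) ++ ([.inl .var, .inl .zero].reverse ++ b)) c (marks j) (marks (i - j)) f)
    rfl i
    fun j hj => ⟨_, marks j, rfl, by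
      obtain ⟨l, hl⟩ : ∃ l, i - j = l + 1 := ⟨i - j - 1, by omega⟩
      rw [show i - (j + 1) = l by omega, hl]
      exact (Runs.push (by simp; rfl)).seq (Runs.push (by simp [List.replicate_succ, marks_succ]))⟩
  have h3 := Runs.forPop_count (s := s) (M := 1) (k := tmp)
    (p := fun _ => .push aux (.inl .one))
    (fun j => all a (List.replicate i (.inl .zero) ++ ([.inl .var, .inl .zero].reverse ++ b)) c (marks (i - j)) (marks j) f)
    rfl i
    fun j hj => ⟨_, marks j, rfl, Runs.push (by
      obtain ⟨l, hl⟩ : ∃ l, i - j = l + 1 := ⟨i - j - 1, by omega⟩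
      rw [show i - (j + 1) = l by omega, hl]
      simp [marks_succ])⟩
  simp only [Nat.sub_self, Nat.sub_zero] at h2 h3
  refine (h1.seq (h2.seq (h3.seq (Runs.push (k := out) (a := .inl .one) ?_)))).mono ?_
  · simp [selWord_reverse, marks]
  · simp; omega

theorem runs_emitNegSel_cnt (d : List (Sym ⊕ Bool)) :
    Runs (emitNegSel cnt) s (all a b (marks i) d [] f) (5 * i + 7) s
      (all a ((negSelWord i).reverse ++ b) (marks i) d [] f) := by
  have := (runs_push_out s _ _ _ _ _ _ _).seq
    (runs_emitSel_cnt s a (.inl .neg :: b) f i d)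
  simpa [negSelWord, emitNegSel] using this.mono (by omega)

theorem runs_emitNegSel_aux (c : List (Sym ⊕ Bool)) :
    Runs (emitNegSel aux) s (all a b c (marks i) [] f) (5 * i + 7) s
      (all a ((negSelWord i).reverse ++ b) c (marks i) [] f) := by
  have := (runs_push_out s _ _ _ _ _ _ _).seq
    (runs_emitSel_aux s a (.inl .neg :: b) f i c)
  simpa [negSelWord, emitNegSel] using this.mono (by omega)

theorem runs_copyCount :
    Runs copyCount s (all a b (marks i) [] [] f) (5 * i + 2) s
      (all a b (marks i) (marks i) [] f) := by
  have h1 := Runs.forPop_count (s := s) (M := 1) (k := cnt)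
    (p := fun _ => .push tmp (.inl .one))
    (fun j => all a b (marks j) [] (marks (i - j)) f) rfl i
    fun j hj => ⟨_, marks j, rfl, Runs.push (by
      obtain ⟨l, hl⟩ : ∃ l, i - j = l + 1 := ⟨i - j - 1, by omega⟩
      rw [show i - (j + 1) = l by omega, hl]
      simp [marks_succ])⟩
  have h2 := Runs.forPop_count (s := s) (M := 2) (k := tmp)
    (p := fun _ => .seq (.push cnt (.inl .one)) (.push aux (.inl .one)))
    (fun j => all a b (marks (i - j)) (marks (i - j)) (marks j) f) rfl i
    fun j hj => ⟨_, marks j, rfl, by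
      obtain ⟨l, hl⟩ : ∃ l, i - j = l + 1 := ⟨i - j - 1, by omega⟩
      rw [show i - (j + 1) = l by omega, hl]
      exact (Runs.push (by simp; rfl)).seq (Runs.push (by simp [marks_succ]))⟩
  simp only [Nat.sub_self, Nat.sub_zero] at h1 h2
  exact (h1.seq h2).mono (by omega)

theorem exclWord_succ : exclWord i (j + 1) =
    .inl .or :: (negSelWord j ++ (negSelWord i ++ exclWord i j)) := by
  simp [exclWord, List.range_succ]

/-- Popping the copied counter leaves j marks, which serve as the number of the other selector. This
is why exclusions are listed in descending order. -/
theorem runs_emitExcl :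
    Runs emitExcl s (all a b (marks i) [] [] f) (10 * i * i + 21 * i + 3) s
      (all a ((exclWord i i).reverse ++ b) (marks i) [] [] f) := by
  have key : ∀ j ≤ i, ∀ b, Runs (.forPop aux fun _ =>
      .seq (.push out (.inl .or)) (.seq (emitNegSel aux) (emitNegSel cnt))) s
      (all a b (marks i) (marks j) [] f) (j * (10 * i + 16) + 1) s
      (all a ((exclWord i j).reverse ++ b) (marks i) [] [] f) := by
    intro j
    induction j with
    | zero => exact fun _ _ => (Runs.forPop_nil rfl).mono (by omega)
    | succ j ih =>
      intro hj b
      refine (Runs.forPop_cons (w := marks j) rfl ((Runs.push (by simp; rfl)).seq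
        ((runs_emitNegSel_aux s a _ f j _).seq (runs_emitNegSel_cnt s a _ f i _)))
        (T'' := all a ((exclWord i (j + 1)).reverse ++ b) (marks i) [] [] f)
        (by simpa [exclWord_succ] using ih (by omega) _)).mono ?_
      have := Nat.add_mul j 1 (10 * i + 16)
      omega
  exact ((runs_copyCount s a b f i).seq (key i le_rfl b)).mono (by ring_nf; omega)

theorem selsWord_succ : selsWord (j + 1) = selWord j ++ selsWord j := by
  simp [selsWord, List.range_succ]

theorem runs_emitSels :
    Runs emitSels s (all a b (marks i) [] [] f) (5 * i * i + 12 * i + 3) s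
      (all a ((selsWord i).reverse ++ b) (marks i) [] [] f) := by
  have key : ∀ j ≤ i, ∀ b, Runs (.forPop aux fun _ => emitSel aux) s
      (all a b (marks i) (marks j) [] f) (j * (5 * i + 7) + 1) s
      (all a ((selsWord j).reverse ++ b) (marks i) [] [] f) := by
    intro j
    induction j with
    | zero => exact fun _ _ => (Runs.forPop_nil rfl).mono (by omega)
    | succ j ih =>
      intro hj b
      refine (Runs.forPop_cons (w := marks j) rfl
        (by simpa using runs_emitSel_aux s a b f j (marks i))
        (T'' := all a ((selsWord (j + 1)).reverse ++ b) (marks i) [] [] f)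
        (by simpa [selsWord_succ] using ih (by omega) _)).mono ?_
      have := Nat.add_mul j 1 (5 * i + 7)
      omega
  exact ((runs_copyCount s a b f i).seq (key i le_rfl b)).mono (by ring_nf; omega)

end

section

variable {Q : Type}

/-- Processes one symbol. The register holds the state of an automaton, the flag for a preceding
negation, and the carry. -/
def step : Sym ⊕ Bool → Prog Stack (Sym ⊕ Bool) (Q × Bool × Bool)
  | .inl .bigOr => .popCases frm fun o => match o with
    | none => .seq (.push frm (.inl .bigOr)) (emit [.inl .and, .inl .bigAnd])
    | some g => .seq (.push frm g) (.seq (.push frm (.inl .close))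
        (.seq (.push out (.inl .bigOr)) (emitNegSel cnt)))
  | .inl .bigAnd => .popCases frm fun o => match o with
    | none => .seq (.push frm (.inl .close)) (.push out (.inl .bigAnd))
    | some g => .seq (.push frm g)
        (if g = .inl .bigOr then .seq (.push frm (.inl .bigAnd)) emitExcl
          else .seq (.push frm (.inl .close)) (.push out (.inl .bigAnd)))
  | .inl .close => .popCases frm fun o =>
      if o = some (.inl .bigOr) then
        .seq (emit [.inl .close, .inl .bigOr]) (.seq emitSels (.push out (.inl .close)))
      else if o = some (.inl .bigAnd) then .push cnt (.inl .one) else .push out (.inl .close)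
  | .inl .neg => .seq (.push out (.inl .or)) (.seq (emitNegSel cnt)
      (.seq (.push out (.inl .neg)) (.set fun r => (r.1, true, r.2.2))))
  | .inl .var => .cases fun r =>
      if r.2.1 then
        .seq (emit [.inl .var, .inl .one]) (.set fun r => (r.1, false, r.2.2))
      else .seq (.push out (.inl .or)) (.seq (emitNegSel cnt)
        (.seq (emit [.inl .var, .inl .one]) (.set fun r => (r.1, false, r.2.2))))
  | .inl c => .push out (.inl c)
  | .inr b => .cases fun r =>
      .seq (.push out (.inr (r.2.2 ^^ b))) (.set fun r => (r.1, r.2.1, r.2.2 && b))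

/-- Opening a member and closing the outermost disjunction run through all earlier selectors, each
of linear length; this is the quadratic cost. All other symbols take at most linear time in the
counter. -/
theorem runs_step (c : Sym ⊕ Bool) (q : Q) (s : TransState) (a b : List (Sym ⊕ Bool)) :
    Runs (step c) (q, s.neg, s.carry) (all a b (marks s.idx) [] [] s.frames)
      (50 * (s.idx + 1) ^ 2) (q, (s.next c).neg, (s.next c).carry)
      (all a ((s.write c).reverse ++ b) (marks (s.next c).idx) [] [] (s.next c).frames) := by
  obtain ⟨F, i, n, k⟩ := s
  have hb : ∀ x, x ≤ 10 * i * i + 50 * i + 40 → x ≤ 50 * (i + 1) ^ 2 := fun x hx =>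
    hx.trans (by ring_nf; nlinarith)
  rcases c with (_ | _ | _ | _ | _ | _ | _ | _ | _) | y
  · refine (Runs.cases ?_).mono (hb (1 + (5 * i + 20)) (by nlinarith))
    cases n with
    | true =>
      have := (runs_emit (q, true, k) a b [] F [.inl .var, .inl .one] (marks i) []).seq
        (Runs.set fun r => (r.1, false, r.2.2))
      exact this.mono (by simp)
    | false =>
      have := (runs_push_out (q, false, k) _ _ _ _ _ _ (.inl .or)).seq
        ((runs_emitNegSel_cnt _ a (.inl .or :: b) F i []).seq
        ((runs_emit _ a _ [] F [.inl .var, .inl .one] (marks i) []).seq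
        (Runs.set fun r => (r.1, false, r.2.2))))
      simpa [write, next] using this.mono (by simp; omega)
  · exact (Runs.push (by simp [write, next])).mono (hb _ (by omega))
  · exact (Runs.push (by simp [write, next])).mono (hb _ (by omega))
  · have := (runs_push_out (q, n, k) _ _ _ _ _ _ (.inl .or)).seq
      ((runs_emitNegSel_cnt _ a (.inl .or :: b) F i []).seq
      ((runs_push_out _ _ _ _ _ _ _ (.inl .neg)).seq
      (Runs.set fun r => (r.1, true, r.2.2))))
    simpa [write, next, step] using this.mono (hb _ (by nlinarith))
  · exact (Runs.push (by simp [write, next])).mono (hb _ (by omega))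
  · exact (Runs.push (by simp [write, next])).mono (hb _ (by omega))
  · refine (Runs.popCases ?_).mono (hb (1 + (10 * i * i + 21 * i + 10)) (by nlinarith))
    cases F with
    | nil =>
      exact ((Runs.push (by simp; rfl)).seq
        (Runs.push (by simp [write, next]))).mono (by omega)
    | cons g F =>
      by_cases hg : g = .inl .bigOr
      · subst hg
        have := (runs_push_frm (q, n, k) a b (marks i) [] [] _ (.inl .bigOr)).seq
          ((runs_push_frm _ _ _ _ _ _ _ (.inl .bigAnd)).seq
          (runs_emitExcl _ a b (.inl .bigAnd :: .inl .bigOr :: F) i))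
        simpa [write, next] using this.mono (by omega)
      · have := (runs_push_frm (q, n, k) a b (marks i) [] [] F g).seq
          ((runs_push_frm _ _ _ _ _ _ _ (.inl .close)).seq
          (runs_push_out _ _ _ _ _ _ _ (.inl .bigAnd)))
        simpa [write, next, hg] using this.mono (by omega)
  · refine (Runs.popCases ?_).mono (hb (1 + (10 * i * i + 21 * i + 10)) (by nlinarith))
    cases F with
    | nil =>
      have := (runs_push_frm (q, n, k) a b (marks i) [] [] _ (.inl .bigOr)).seq
          (runs_emit _ a b [] [.inl .bigOr] [.inl .and, .inl .bigAnd] (marks i) [])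
      simpa [write, next] using this.mono (by simp)
    | cons g F =>
      have := (runs_push_frm (q, n, k) a b (marks i) [] [] F g).seq
          ((runs_push_frm _ _ _ _ _ _ _ (.inl .close)).seq
          ((runs_push_out _ _ _ _ _ _ _ (.inl .bigOr)).seq
          (runs_emitNegSel_cnt _ a _ _ i [])))
      simpa [write, next] using this.mono (by nlinarith)
  · refine (Runs.popCases ?_).mono (hb (1 + (10 * i * i + 21 * i + 10)) (by nlinarith))
    simp only [all_frm, update_frm]
    by_cases h1 : F.head? = some (.inl .bigOr)
    · have := (runs_emit (q, n, k) a b [] F.tail [.inl .close, .inl .bigOr] (marks i) []).seq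
        ((runs_emitSels _ a _ F.tail i).seq (runs_push_out _ _ _ _ _ _ _ (.inl .close)))
      simpa [write, next, h1] using this.mono (by simp; nlinarith)
    · by_cases h2 : F.head? = some (.inl .bigAnd)
      · simp only [write, next, h2]
        exact (Runs.push (by simp [marks_succ])).mono (by omega)
      · simp only [write, next, h1, h2, if_false]
        exact (Runs.push (by simp)).mono (by omega)
  · refine (Runs.cases ((Runs.push (by simp; rfl)).seq (Runs.set _))).mono (hb _ (by omega))

/-- Empties a stack. -/
def clear {S : Type} (k : Stack) : Prog Stack (Sym ⊕ Bool) S := .forPop k fun _ => .set id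

theorem runs_clear {S : Type} (k : Stack) (s : S) (T : Stack → List (Sym ⊕ Bool)) :
    Runs (clear k) s T (2 * (T k).length + 1) s (Function.update T k []) := by
  generalize hw : T k = w
  induction w generalizing T with
  | nil =>
    rw [← hw, Function.update_eq_self]
    exact (Runs.forPop_nil hw).mono (by omega)
  | cons a w ih =>
    have := ih (Function.update T k w) (by simp)
    rw [Function.update_idem] at this
    exact (Runs.forPop_cons hw (Runs.set id) this).mono (by simp; omega)

theorem runs_move {S : Type} (s : S) (a b c d e f : List (Sym ⊕ Bool)) :
    Runs (.forPop out fun x => .push inp x) s (all a b c d e f) (2 * b.length + 1) s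
      (all (b.reverse ++ a) [] c d e f) := by
  induction b generalizing a with
  | nil => exact (Runs.forPop_nil rfl).mono (by omega)
  | cons x b ih =>
    refine (Runs.forPop_cons (T := all a (x :: b) c d e f) (w := b) rfl
      (by simpa using runs_push_inp s a b c d e f x) (by simpa using ih (x :: a))).mono (by simp; omega)

/-- Writes the last digit of the parameter, or rejects, and moves the result to the stack of the
input and output. -/
def finish (acc : Q → Bool) : Prog Stack (Sym ⊕ Bool) (Q × Bool × Bool) :=
  .seq (.cases fun r => if acc r.1 then (if r.2.2 then .push out (.inr true) else .set id)
      else clear out)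
    (.seq (.forPop out fun x => .push inp x) (.seq (clear cnt) (clear frm)))

/-- Moving the output reverses it back into reading order. A rejected word leaves the empty output.
-/
theorem runs_finish (acc : Q → Bool) (q : Q) (s : TransState) (w : List (Sym ⊕ Bool)) (N : ℕ)
    (h1 : w.length ≤ N) (h2 : s.idx ≤ N) (h3 : s.frames.length ≤ N) :
    Runs (finish acc) (q, s.neg, s.carry) (all [] w.reverse (marks s.idx) [] [] s.frames)
      (8 * N + 20) (q, s.neg, s.carry)
      (all (if acc q then w ++ s.carryWord else []) [] [] [] [] []) := by
  obtain ⟨F, i, n, k⟩ := s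
  have key : ∀ v : List (Sym ⊕ Bool), v.length ≤ N + 1 →
      Runs (.seq (.forPop out fun x => .push inp x) (.seq (clear cnt) (clear frm))) (q, n, k)
        (all [] v.reverse (marks i) [] [] F) (6 * N + 10) (q, n, k) (all v [] [] [] [] []) := by
    intro v hv
    have := (runs_move (q, n, k) [] v.reverse (marks i) [] [] F).seq
      ((runs_clear cnt _ _).seq (runs_clear frm _ _))
    have hm : (marks i).length = i := List.length_replicate
    simp only [List.reverse_reverse, List.append_nil, update_cnt, update_frm, all_cnt, all_frm,
      hm, List.length_reverse] at this
    exact this.mono (by simp only at h2 h3; omega)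
  simp only
  by_cases ha : acc q
  · cases k with
    | true =>
      refine ((Runs.cases (N := 1) ?_).seq (key (w ++ [.inr true]) (by simp [h1]))).mono (M := 8 * N + 20) (by omega) |>
        fun h => by simpa [finish, ha, carryWord] using h
      simp only [ha, if_true]
      exact Runs.push (by simp)
    | false =>
      refine ((Runs.cases (N := 1) ?_).seq (key w (h1.trans (by omega)))).mono (M := 8 * N + 20) (by omega) |>
        fun h => by simpa [finish, ha, carryWord] using h
      simp only [ha, if_true]
      exact Runs.set id
  · refine ((Runs.cases (N := 2 * N + 1) ?_).seq (key [] (by simp))).mono (M := 8 * N + 20) (by omega) |>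
      fun h => by simpa [finish, ha] using h
    simp only [ha]
    have := runs_clear out (q, n, k) (all [] w.reverse (marks i) [] [] F)
    simpa using this.mono (by simpa using h1)

/-- The translation of words as a program; its input is checked by an automaton. -/
def translate (δ : Q → Sym ⊕ Bool → Q) (acc : Q → Bool) :
    Prog Stack (Sym ⊕ Bool) (Q × Bool × Bool) :=
  .seq (.forPop inp fun c => .seq (step c) (.set fun r => (δ r.1 c, r.2))) (finish acc)

theorem next_idx_le (s : TransState) (c : Sym ⊕ Bool) : (s.next c).idx ≤ s.idx + 1 := by
  rcases c with (_ | _ | _ | _ | _ | _ | _ | _ | _) | y <;> simp only [next] <;> try omega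
  split <;> omega

/-- The counter grows by at most one per symbol and so stays below `L`. The automaton runs alongside
the translation in the register. -/
theorem runs_loop (δ : Q → Sym ⊕ Bool → Q) (w : List (Sym ⊕ Bool)) (q : Q) (s : TransState)
    (b : List (Sym ⊕ Bool)) (L : ℕ) (hL : s.idx + w.length ≤ L) :
    Runs (.forPop inp fun c => .seq (step c) (.set fun r => (δ r.1 c, r.2)))
      (q, s.neg, s.carry) (all w b (marks s.idx) [] [] s.frames)
      (w.length * (50 * (L + 1) ^ 2 + 2) + 1)
      (w.foldl δ q, (s.run w).1.neg, (s.run w).1.carry)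
      (all [] ((s.run w).2.reverse ++ b) (marks (s.run w).1.idx) [] [] (s.run w).1.frames) := by
  induction w generalizing q s b with
  | nil => exact (Runs.forPop_nil rfl).mono (by omega)
  | cons c w ih =>
    have h1 := next_idx_le s c
    simp only [List.length_cons] at hL
    have h2 := ih (δ q c) (s.next c) ((s.write c).reverse ++ b) (by omega)
    have h3 := (runs_step c q s w b).seq (Runs.set fun r => (δ r.1 c, r.2))
    have h4 : (s.idx + 1) ^ 2 ≤ (L + 1) ^ 2 := Nat.pow_le_pow_left (by omega) 2
    have h5 := (Runs.forPop_cons (k := inp) (T := all (c :: w) b (marks s.idx) [] [] s.frames)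
      (p := fun c => .seq (step c) (.set fun r => (δ r.1 c, r.2))) rfl
      (by simpa using h3) h2).mono (M := (w.length + 1) * (50 * (L + 1) ^ 2 + 2) + 1)
      (by have := Nat.add_mul w.length 1 (50 * (L + 1) ^ 2 + 2); omega)
    simpa [run] using h5

theorem runs_translate (δ : Q → Sym ⊕ Bool → Q) (acc : Q → Bool) (q : Q)
    (w : List (Sym ⊕ Bool)) :
    ∃ r, Runs (translate δ acc) (q, false, true) (all w [] [] [] [] [])
      (499 * (w.length + 1) ^ 3) r
      (all (if acc (w.foldl δ q) then
        (run ⟨[], 0, false, true⟩ w).2 ++ (run ⟨[], 0, false, true⟩ w).1.carryWord else [])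
        [] [] [] [] []) := by
  -- The actual step count n is extracted because it bounds the stack lengths that `finish` has to
  -- process.
  obtain ⟨n, hn, h⟩ := runs_loop δ w q ⟨[], 0, false, true⟩ [] w.length (by simp)
  have ho := h.length_le out
  have hc := h.length_le cnt
  have hf := h.length_le frm
  simp only [marks, all_out, all_cnt, all_frm, List.append_nil, List.length_reverse,
    List.length_replicate, List.length_nil, zero_add] at ho hc hf
  rw [List.append_nil] at h
  refine ⟨_, (Runs.seq ⟨n, le_rfl, h⟩ (runs_finish acc _ _ _ n ho hc hf)).mono ?_⟩
  -- The total n + (8n + 20) is then at most (9 * 52 + 20) (|w| + 1)³, below the factor 499.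
  have : w.length * (50 * (w.length + 1) ^ 2 + 2) + 1 ≤ 52 * (w.length + 1) ^ 3 := by
    ring_nf; nlinarith
  have h1 : 1 ≤ (w.length + 1) ^ 3 := Nat.one_le_pow _ _ (by omega)
  omega

end

end Trans

end FPT

-- Assembly of the fpt-reduction.

namespace FPT

open Prog Stack PropFormula

theorem pairWord_injective {A B : Type} : Function.Injective (pairWord (A := A) (B := B)) := by
  rintro ⟨x, y⟩ ⟨x', y'⟩ h
  simp only [pairWord] at h
  have h1 := congrArg (List.filterMap Sum.getLeft?) h
  have h2 := congrArg (List.filterMap Sum.getRight?) h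
  simp [List.filterMap_append, List.filterMap_map, Function.comp_def] at h1 h2
  rw [h1, h2]

theorem length_bits_succ_le (k : ℕ) : (k + 1).bits.length ≤ k.bits.length + 1 := by
  rw [Nat.size_eq_bits_len, Nat.size_eq_bits_len, Nat.size_le, pow_succ]
  have := Nat.lt_size_self k
  omega

theorem wSat_encode_mem_yes {C : Set PropFormula} {a : PropFormula} (ha : a ∈ C) (k : ℕ) :
    (a.encode, k.bits) ∈ (WSat C).yes ↔ a.KSat k := by
  constructor
  · rintro ⟨b, -, l, h, hs⟩
    rw [Prod.mk.injEq] at h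
    rwa [encode_injective h.1, Nat.bits_injective h.2]
  · exact fun h => ⟨a, ha, k, rfl, h⟩

theorem fptReducible_delta_omega (t d : ℕ) (ht : 1 ≤ t) :
    FptReducible (WSat (Delta (t + 1) d)) (WSat (Omega t (t + d + 3))) := by
  classical
  obtain ⟨Q, _, M, hM⟩ := isRegular_instanceWords (t + 1) d
  let acc : Q → Bool := fun q => decide (q ∈ M.accept)
  have hacc : ∀ w, acc (w.foldl M.step M.start) = true ↔ w ∈ instanceWords (t + 1) d := by
    intro w
    rw [← hM, DFA.mem_accepts]
    exact decide_eq_true_iff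
  -- The reduction is read off from the output of the program: on every input, that output presents
  -- a pair of words with the right answer.
  have key : ∀ z : List Sym × List Bool, ∃ r : List Sym × List Bool,
      (if acc ((pairWord z).foldl M.step M.start) then
        (TransState.run ⟨[], 0, false, true⟩ (pairWord z)).2 ++
          (TransState.run ⟨[], 0, false, true⟩ (pairWord z)).1.carryWord else []) = pairWord r ∧
      (z ∈ (WSat (Delta (t + 1) d)).yes ↔ r ∈ (WSat (Omega t (t + d + 3))).yes) ∧
      r.2.length ≤ z.2.length + 1 := by
    intro z
    by_cases hz : pairWord z ∈ instanceWords (t + 1) d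
    · rw [if_pos ((hacc _).2 hz)]
      obtain ⟨a, ha, k, hk⟩ := hz
      obtain rfl := pairWord_injective hk
      obtain ⟨ms, rfl, hms⟩ := exists_blocks ht ha
      refine ⟨((reduct ms).encode, (k + 1).bits), TransState.run_instance
        (fun m hm a ha => (nnf_of_mem _ _).2 a (hms m hm a ha)) k rfl, ?_,
        length_bits_succ_le k⟩
      rw [wSat_encode_mem_yes ha, wSat_encode_mem_yes (reduct_mem_Omega ht hms), kSat_reduct hms]
    · rw [if_neg (mt (hacc _).1 hz)]
      -- The empty output is a no-instance, since no formula has an empty encoding.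
      refine ⟨([], []), rfl, iff_of_false ?_ ?_, by simp⟩
      · rintro ⟨a, ha, k, rfl, -⟩
        exact hz ⟨a, ha, k, rfl⟩
      · rintro ⟨a, -, k, h, -⟩
        exact encode_ne_nil a (Prod.mk.inj h).1.symm
  choose R hR hyes hlen using key
  have hout : ∀ (x : List Sym) (y : List Bool), Nonempty (Turing.TM2OutputsInTime
      ((Trans.translate M.step acc).machine inp (M.start, false, true)) (pairWord (x, y))
      (some (pairWord (R (x, y)))) ((y.length + 1) ^ 3 *
        (500 * (Polynomial.X + 1) ^ 3 : Polynomial ℕ).eval x.length)) := by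
    intro x y
    obtain ⟨r, n, hn, h⟩ := Trans.runs_translate M.step acc M.start (pairWord (x, y))
    rw [hR (x, y), all_input, all_input] at h
    refine h.outputs ?_
    have hw : (pairWord (x, y)).length = x.length + y.length := by simp [pairWord]
    -- This splits the cubic bound in |x| + |y| into a factor for the parameter and a polynomial in
    -- |x|. The constant 500 is 499 with room for the halting step.
    have h1 : x.length + y.length + 1 ≤ (x.length + 1) * (y.length + 1) := by ring_nf; omega
    have h2 := Nat.pow_le_pow_left h1 3
    have h3 : 1 ≤ (x.length + y.length + 1) ^ 3 := Nat.one_le_pow _ _ (by omega)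
    have h4 : (500 * (Polynomial.X + 1) ^ 3 : Polynomial ℕ).eval x.length =
        500 * (x.length + 1) ^ 3 := by simp
    rw [hw] at hn
    rw [mul_pow] at h2
    rw [h4]
    calc n + 1 ≤ 500 * ((x.length + 1) ^ 3 * (y.length + 1) ^ 3) := by omega
      _ = _ := by ring
  refine ⟨R, hyes, ⟨fun n => n + 1, Computable.succ, fun x y => hlen (x, y)⟩,
    ⟨(Trans.translate M.step acc).machine inp (M.start, false, true), Equiv.refl _,
    Equiv.refl _⟩, fun n => (n + 1) ^ 3, 500 * (Polynomial.X + 1) ^ 3, ?_, fun x y => ?_⟩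
  · have h : Primrec fun n : ℕ => (n + 1) * (n + 1) * (n + 1) :=
      Primrec.nat_mul.comp (Primrec.nat_mul.comp Primrec.succ Primrec.succ) Primrec.succ
    exact (h.of_eq fun n => by ring).to_comp
  · have hid : ∀ w : List (Sym ⊕ Bool), w = w.map (Equiv.refl _).symm := fun w =>
      (List.map_id w).symm
    have h := hout x y
    rw [hid (pairWord (x, y)), hid (pairWord (R (x, y)))] at h
    exact h

end FPT

theorem mainTheorem11 (t d : ℕ) (ht : 1 ≤ t) (hd : 1 ≤ d) :
    FPT.WSat (FPT.Delta (t + 1) d) ∈ FPT.W t :=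
  ⟨_, ⟨t + d + 3, by omega, rfl⟩, FPT.fptReducible_delta_omega t d ht⟩
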